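/- Let $V:\mathbb R^n\to\mathbb R$ be smooth and let $M\subset\mathbb R^n$ be a compact smooth embedded $(n-1)$-dimensional manifold (without boundary) of critical points of $V$ that is non-degenerate, i.e. $\ker V''(x)=T_xM$ for all $x\in M$. Suppose that $V$ is repulsive with respect to $M$, i.e. $V''(x)[n_x,n_x]<0$ for every $x\in M$ and every unit normal vector $n_x$ to $M$ at $x$. Let $S^1=\mathbb R/\mathbb Z$ and let $x_0:S^1\to M$ be a closed geodesic (a smooth closed curve with $\nabla_{\dot x_0}\dot x_0=0$, where $\nabla$ is the Levi-Civita connection of $M$) that is non-degenerate, i.e. the bilinear form $$D^2L_0(x_0)[k,w]=\int_{S^1}\bigl(\nabla_{\dot x_0}k,\nabla_{\dot x_0}w\bigr)\,dt-\int_{S^1}\bigl(R(k,\dot x_0)\dot x_0,w\bigr)\,dt$$ (the second differential at $x_0$ of $L_0(u)=\tfrac12\int_{S^1}|\dot u|^2$ on $H^1(S^1;M)$, with $R$ the Riemann tensor of $M$) on the space of $H^1$ vector fields along $x_0$ tangent to $M$ has a one-dimensional kernel. Then there exists $T_0>0$ with the following property: for every $T\ge T_0$ there exists a function $u_T:\mathbb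 R\to\mathbb R^n$ such that (i) $u_T$ is a $T$-periodic solution of $\ddot x+V'(x)=0$; (ii) as $T\to+\infty$, $u_T(T\,\cdot)\to x_0(\cdot)$ in $C^1(S^1;\mathbb R^n)$. -/

import Mathlib

open Set Filter Topology MeasureTheory
open scoped ContDiff RealInnerProductSpace

namespace SlowOrbits

/-- The Euclidean space `ℝⁿ`. -/
abbrev Euc (n : ℕ) : Type := EuclideanSpace ℝ (Fin n)

variable {n : ℕ}

/-- `M` is a smooth embedded submanifold of `ℝⁿ` of codimension one, without boundary: near each
of its points it is the zero set of a smooth real function with nowhere vanishing differential. -/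
def IsSmoothHypersurface (M : Set (Euc n)) : Prop :=
  ∀ x ∈ M, ∃ U : Set (Euc n), IsOpen U ∧ x ∈ U ∧ ∃ F : Euc n → ℝ,
    ContDiffOn ℝ ∞ F U ∧ (∀ y ∈ U, fderiv ℝ F y ≠ 0) ∧ M ∩ U = {y ∈ U | F y = 0}

/-- The tangent space `T_x M`, as a subspace of `ℝⁿ`.  (For an embedded submanifold the tangent
cone is already a linear space; the span only makes it a `Submodule`.) -/
def tangentSpaceAt (M : Set (Euc n)) (x : Euc n) : Submodule ℝ (Euc n) :=
  Submodule.span ℝ (tangentConeAt ℝ M x)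

/-- The second differential `V''(x)[v, w]`. -/
noncomputable def hess (V : Euc n → ℝ) (x v w : Euc n) : ℝ :=
  fderiv ℝ (fderiv ℝ V) x v w

/-- `M` is a compact non-degenerate critical hypersurface of `V`: a compact smooth hypersurface
consisting of critical points of `V`, with `ker V''(x) = T_x M` for all `x ∈ M`. -/
structure IsNondegenerateCriticalHypersurface (V : Euc n → ℝ) (M : Set (Euc n)) : Prop where
  compact : IsCompact M
  smooth : IsSmoothHypersurface M
  critical : ∀ x ∈ M, gradient V x = 0
  ker_hess : ∀ x ∈ M, ∀ v : Euc n, (∀ w, hess V x v w = 0) ↔ v ∈ tangentSpaceAt M x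

/-- `V` is repulsive with respect to `M`: `V''(x)[n_x, n_x] < 0` for every unit normal vector
`n_x` to `M` at a point `x ∈ M`. -/
def IsRepulsive (V : Euc n → ℝ) (M : Set (Euc n)) : Prop :=
  ∀ x ∈ M, ∀ ν ∈ (tangentSpaceAt M x)ᗮ, ‖ν‖ = 1 → hess V x ν ν < 0

/-- The second fundamental form `s_x(v, w) = (D_v W)^⊥` of `M`, for `v, w ∈ T_x M`, with values
in the normal space.  Here `W` is the tangent field `W(y) = (projection of w to T_y M)` on `M`,
which extends `w`.  The derivative of `W` within `M` is applied only to tangent vectors, where it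
does not depend on the choice of a derivative. -/
noncomputable def secondFundamentalForm (M : Set (Euc n)) (x v w : Euc n) : Euc n :=
  (tangentSpaceAt M x)ᗮ.starProjection
    (fderivWithin ℝ (fun y => (tangentSpaceAt M y).starProjection w) M x v)

/-- The Riemann curvature `(R(X, Y) Z, W)` of `M ⊆ ℝⁿ` at `x`, through the Gauss equations. -/
noncomputable def riemann (M : Set (Euc n)) (x X Y Z W : Euc n) : ℝ :=
  ⟪secondFundamentalForm M x Y Z, secondFundamentalForm M x X W⟫
    - ⟪secondFundamentalForm M x X Z, secondFundamentalForm M x Y W⟫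

/-- The Levi-Civita covariant derivative `∇_{ċ} k` at time `t` of a vector field `k` along the
curve `c` in `M`: the tangential projection of the derivative. -/
noncomputable def covDeriv (M : Set (Euc n)) (c k : ℝ → Euc n) (t : ℝ) : Euc n :=
  (tangentSpaceAt M (c t)).starProjection (deriv k t)

/-- A closed geodesic on `M`, parametrized on `S¹ = ℝ / ℤ`: a smooth `1`-periodic curve `h` in
`M` with `∇_{ḣ} ḣ = 0`. -/
structure IsClosedGeodesic (M : Set (Euc n)) (h : ℝ → Euc n) : Prop where
  smooth : ContDiff ℝ ∞ h
  periodic : Function.Periodic h 1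
  mem : ∀ t, h t ∈ M
  geodesic : ∀ t, covDeriv M h (deriv h) t = 0

/-- `k ∈ H¹(S¹; ℝⁿ)`: a `1`-periodic function which on a period is the primitive of a square
integrable function (this is the continuous representative). -/
def IsH1Loop (k : ℝ → Euc n) : Prop :=
  Function.Periodic k 1 ∧ ∃ g : ℝ → Euc n, MemLp g 2 (volume.restrict (Icc (0 : ℝ) 1)) ∧
    ∀ t ∈ Icc (0 : ℝ) 1, k t = k 0 + ∫ s in (0 : ℝ)..t, g s

/-- `k ∈ T_h H¹(S¹; M)`: the `H¹` vector fields along `h` that are tangent to `M`. -/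
def IsTangentField (M : Set (Euc n)) (h k : ℝ → Euc n) : Prop :=
  IsH1Loop k ∧ ∀ t, k t ∈ tangentSpaceAt M (h t)

/-- The second differential `D²L₀(h)[k, w]` of `L₀(u) = ½ ∫ |u̇|²` on `H¹(S¹; M)` at a closed
geodesic `h`. -/
noncomputable def secondVariation (M : Set (Euc n)) (h k w : ℝ → Euc n) : ℝ :=
  (∫ t in (0 : ℝ)..1, ⟪covDeriv M h k t, covDeriv M h w t⟫)
    - ∫ t in (0 : ℝ)..1, riemann M (h t) (k t) (deriv h t) (deriv h t) (w t)

/-- The kernel of `D²L₀(h)` on `T_h H¹(S¹; M)`. -/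
def secondVariationKernel (M : Set (Euc n)) (h : ℝ → Euc n) : Set (ℝ → Euc n) :=
  {k | IsTangentField M h k ∧ ∀ w, IsTangentField M h w → secondVariation M h k w = 0}

/-- `h` is a non-degenerate closed geodesic: the kernel of `D²L₀(h)` is one-dimensional. -/
def IsNondegenerateClosedGeodesic (M : Set (Euc n)) (h : ℝ → Euc n) : Prop :=
  IsClosedGeodesic M h ∧ ∃ k₀ ∈ secondVariationKernel M h, k₀ ≠ 0 ∧
    ∀ k ∈ secondVariationKernel M h, ∃ c : ℝ, k = c • k₀

/-- `u` is a (classical) `T`-periodic solution of `ü + V'(u) = 0`. -/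
def IsPeriodicSolution (V : Euc n → ℝ) (T : ℝ) (u : ℝ → Euc n) : Prop :=
  ContDiff ℝ 2 u ∧ Function.Periodic u T ∧ ∀ t, deriv (deriv u) t + gradient V (u t) = 0

/-- Convergence in `C¹(S¹; ℝⁿ)`, as `T → +∞`, of a family of `1`-periodic curves. -/
def TendstoC1 (v : ℝ → ℝ → Euc n) (h : ℝ → Euc n) : Prop :=
  TendstoUniformly v h atTop ∧ TendstoUniformly (fun T => deriv (v T)) (deriv h) atTop

end SlowOrbits

open SlowOrbits

/-! With v(t) = u(Tt) and δ = T^(-1/3), the problem is to find 1-periodic solutions of v'' + δ⁻⁶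
V'(v) = 0 close to the geodesic x₀. The cube root only serves to make all exponents below integers.

On M the Hessian is tr V'' times the normal projection N, and repulsiveness makes λ = -tr V''
positive. The linearized normal equation δ⁶ q'' - λ q = g therefore has no resonances and is
solvable with bounds uniform in δ, which is why every large T is allowed. The displacement δ⁶ y with
V''(x₀) y = -x₀'' supplies the constraint force of the geodesic. Through y, tangential perturbations
k feel the third derivative of V, by the operator P (k'' + V'''(x₀)[y, k]) with P = 1 - N. As the
second fundamental form is -V''' / tr V'', the Gauss equations identify this with the Jacobi
operator of x₀ (`inner_covDeriv_sub_riemann`, `mem_secondVariationKernel`).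

The rest is a Lyapunov-Schmidt reduction. Non-degeneracy makes x₀' span the Jacobi fields, so the
Jacobi equation is solvable modulo x₀' (`exists_tangential_solver`, a Fredholm argument). The ansatz
v = x₀ + δ⁶ y + δ⁵ k + δ⁹ N q becomes a fixed point problem for the right-hand sides (f, g) of the
equations for k and q. Since V'''[k, k] is normal for tangent k (`inner_thirdOp_eq_zero`), the
quadratic term of order δ⁴ stays out of the tangential equation, which lives at order δ⁵. The
contraction principle then yields v'' + δ⁻⁶ V'(v) = a x₀' (`exists_damped_solution`). Integrating
the energy over a period gives a ∫ ⟨x₀', v'⟩ = 0, and v' is close to x₀', so a = 0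
(`damping_eq_zero`). A constant geodesic is itself an equilibrium. -/

namespace SlowOrbits

/-- The Banach space of continuous loops `S¹ → F`. -/
abbrev Loop (F : Type*) [TopologicalSpace F] : Type _ := C(UnitAddCircle, F)

/-! ### Continuous loops as functions on the circle -/

section Loops

variable {F : Type*} [NormedAddCommGroup F]

/-- The loop defined by a continuous `1`-periodic function. -/
def loopOf (u : ℝ → F) (hu : Continuous u) (hp : Function.Periodic u 1) : Loop F :=
  ⟨hp.lift, continuous_coinduced_dom.mpr hu⟩

@[simp] theorem loopOf_apply (u : ℝ → F) (hu : Continuous u) (hp : Function.Periodic u 1) (t : ℝ) :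
    loopOf u hu hp (t : UnitAddCircle) = u t := rfl

theorem Loop.ext {f g : Loop F} (h : ∀ t : ℝ, f (t : UnitAddCircle) = g (t : UnitAddCircle)) :
    f = g := by
  ext x
  obtain ⟨t, rfl⟩ := QuotientAddGroup.mk_surjective x
  exact h t

theorem Loop.norm_le {f : Loop F} {C : ℝ} (hC : 0 ≤ C)
    (h : ∀ t : ℝ, ‖f (t : UnitAddCircle)‖ ≤ C) : ‖f‖ ≤ C := by
  rw [ContinuousMap.norm_le _ hC]
  intro x
  obtain ⟨t, rfl⟩ := QuotientAddGroup.mk_surjective x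
  exact h t

theorem Loop.norm_apply_le (f : Loop F) (t : ℝ) : ‖f (t : UnitAddCircle)‖ ≤ ‖f‖ :=
  f.norm_coe_le_norm _

theorem Loop.continuous_lift (f : Loop F) : Continuous fun t : ℝ => f (t : UnitAddCircle) :=
  f.continuous.comp (AddCircle.continuous_mk' 1)

theorem Loop.periodic_lift (f : Loop F) :
    Function.Periodic (fun t : ℝ => f (t : UnitAddCircle)) 1 := by
  intro t
  simp

end Loops

/-! ### Periodic Green operators with sharp bounds -/

section Green

variable {F : Type*} [NormedAddCommGroup F] [NormedSpace ℝ F]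

theorem integral_exp_mul_sub {μ : ℝ} (hμ : μ ≠ 0) (a b : ℝ) :
    ∫ r in a..b, Real.exp (μ * r) = (Real.exp (μ * b) - Real.exp (μ * a)) / μ := by
  rw [intervalIntegral.integral_eq_sub_of_hasDerivAt (f := fun r => Real.exp (μ * r) / μ)]
  · ring
  · intro r _
    have h := (((hasDerivAt_id r).const_mul μ).exp).div_const μ
    simp only [id, mul_one] at h
    rwa [mul_div_cancel_right₀ _ hμ] at h
  · exact (by fun_prop : Continuous fun r : ℝ => Real.exp (μ * r)).intervalIntegrable _ _

/-- The periodic solution operator of `a' + μ a = g`. -/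
theorem exists_green_firstOrder [CompleteSpace F] {μ : ℝ} (hμ : μ ≠ 0) : ∃ S : Loop F →L[ℝ] Loop F,
    (∀ (g : Loop F) (t : ℝ), HasDerivAt (fun t : ℝ => S g (t : UnitAddCircle))
      (g (t : UnitAddCircle) - μ • S g (t : UnitAddCircle)) t) ∧
    ∀ g, ‖S g‖ ≤ |μ|⁻¹ * ‖g‖ := by
  have hc0 : 1 - Real.exp (-μ) ≠ 0 := by
    intro h
    have : Real.exp (-μ) = 1 := by linarith
    rw [Real.exp_eq_one_iff] at this
    exact hμ (by linarith)
  set c : ℝ := (1 - Real.exp (-μ))⁻¹ with hc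
  let φ : Loop F → ℝ → F := fun g r => Real.exp (μ * r) • g (r : UnitAddCircle)
  have hφ : ∀ g, Continuous (φ g) := fun g =>
    (by fun_prop : Continuous fun r : ℝ => Real.exp (μ * r)).smul g.continuous_lift
  have hii : ∀ g a b, IntervalIntegrable (φ g) volume a b := fun g a b =>
    (hφ g).intervalIntegrable a b
  -- Variation of constants over the last period. For μ > 0 the factor `c` sums the geometric series
  -- of contributions of all earlier periods.
  let S₀ : Loop F → ℝ → F := fun g t => (c * Real.exp (-(μ * t))) • ∫ r in (t - 1)..t, φ g r
  have hderiv : ∀ (g : Loop F) (t : ℝ), HasDerivAt (S₀ g) (g (t : UnitAddCircle) - μ • S₀ g t) t := by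
    intro g t
    have h1 : HasDerivAt (fun t => ∫ r in (0:ℝ)..t, φ g r) (φ g t) t :=
      intervalIntegral.integral_hasDerivAt_right (hii g _ _)
        ((hφ g).stronglyMeasurableAtFilter _ _) (hφ g).continuousAt
    have h2 : HasDerivAt (fun t => ∫ r in (0:ℝ)..(t - 1), φ g r) (φ g (t - 1)) t := by
      have h := intervalIntegral.integral_hasDerivAt_right (hii g 0 (t - 1))
        ((hφ g).stronglyMeasurableAtFilter _ _) (hφ g).continuousAt
      exact h.comp_sub_const t 1
    have h3 : HasDerivAt (fun t => ∫ r in (t - 1)..t, φ g r) (φ g t - φ g (t - 1)) t := by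
      refine (h1.sub h2).congr_of_eventuallyEq (Eventually.of_forall fun s => ?_)
      exact (intervalIntegral.integral_interval_sub_left (hii g _ _) (hii g _ _)).symm
    have h4 : HasDerivAt (fun t => c * Real.exp (-(μ * t)))
        (c * (Real.exp (-(μ * t)) * (-μ))) t := by
      have := ((((hasDerivAt_id t).const_mul μ).neg).exp).const_mul c
      simpa using this
    refine (h4.smul h3).congr_deriv ?_
    have hper : g ((t - 1 : ℝ) : UnitAddCircle) = g (t : UnitAddCircle) := by
      have := g.periodic_lift (t - 1)
      simpa using this.symm
    have e1 : Real.exp (-(μ * t)) * Real.exp (μ * t) = 1 := by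
      rw [← Real.exp_add]; simp
    have e2 : Real.exp (-(μ * t)) * Real.exp (μ * (t - 1)) = Real.exp (-μ) := by
      rw [← Real.exp_add]; ring_nf
    have e3 : c * (1 - Real.exp (-μ)) = 1 := inv_mul_cancel₀ hc0
    simp only [φ, S₀, hper, smul_sub, smul_smul]
    rw [mul_assoc c, mul_assoc c, e1, e2, ← sub_smul, ← mul_sub, e3, one_smul]
    rw [show c * (Real.exp (-(μ * t)) * -μ) = -(μ * (c * Real.exp (-(μ * t)))) by ring, neg_smul]
    abel
  have hcont : ∀ g, Continuous (S₀ g) := fun g =>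
    continuous_iff_continuousAt.2 fun t => (hderiv g t).continuousAt
  have hper : ∀ g, Function.Periodic (S₀ g) 1 := by
    intro g t
    simp only [S₀]
    have h : ∫ r in (t + 1 - 1)..(t + 1), φ g r = Real.exp μ • ∫ r in (t - 1)..t, φ g r := by
      rw [← intervalIntegral.integral_smul]
      have := intervalIntegral.integral_comp_add_right (a := t - 1) (b := t) (φ g) 1
      rw [show t + 1 - 1 = t - 1 + 1 by ring, ← this]
      refine intervalIntegral.integral_congr fun r _ => ?_
      simp only [φ, smul_smul, g.periodic_lift r, ← Real.exp_add]
      congr 2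
      ring
    rw [h, smul_smul]
    congr 1
    rw [mul_assoc, ← Real.exp_add]
    congr 2
    ring
  -- The kernel has constant sign and total mass 1/μ, so no constant is lost. The contraction
  -- estimate for the normal equation depends on this sharpness.
  have hbound : ∀ g t, ‖S₀ g t‖ ≤ |μ|⁻¹ * ‖g‖ := by
    intro g t
    have h1 : ‖∫ r in (t - 1)..t, φ g r‖ ≤ ∫ r in (t - 1)..t, Real.exp (μ * r) * ‖g‖ := by
      refine intervalIntegral.norm_integral_le_of_norm_le (by linarith)
        (Eventually.of_forall fun r _ => ?_)
        ((by fun_prop : Continuous fun r : ℝ => Real.exp (μ * r) * ‖g‖).intervalIntegrable _ _)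
      simp only [φ, norm_smul, Real.norm_eq_abs, Real.abs_exp]
      gcongr
      exact g.norm_apply_le r
    rw [intervalIntegral.integral_mul_const, integral_exp_mul_sub hμ] at h1
    simp only [S₀, norm_smul, Real.norm_eq_abs, abs_mul, Real.abs_exp]
    calc |c| * Real.exp (-(μ * t)) * ‖∫ r in (t - 1)..t, φ g r‖
        ≤ |c| * Real.exp (-(μ * t)) *
          ((Real.exp (μ * t) - Real.exp (μ * (t - 1))) / μ * ‖g‖) := by gcongr
      _ = |c| * ((Real.exp (-(μ * t)) * Real.exp (μ * t)
            - Real.exp (-(μ * t)) * Real.exp (μ * (t - 1))) / μ) * ‖g‖ := by ring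
      _ = |c| * ((1 - Real.exp (-μ)) / μ) * ‖g‖ := by
        rw [← Real.exp_add, ← Real.exp_add, show -(μ * t) + μ * t = 0 by ring,
          show -(μ * t) + μ * (t - 1) = -μ by ring, Real.exp_zero]
      _ ≤ |c| * |(1 - Real.exp (-μ)) / μ| * ‖g‖ := by gcongr; exact le_abs_self _
      _ = |μ|⁻¹ * ‖g‖ := by
        rw [hc, abs_div, abs_inv]
        field_simp [abs_ne_zero.2 hc0]
  let L : Loop F →ₗ[ℝ] Loop F :=
    { toFun := fun g => loopOf (S₀ g) (hcont g) (hper g)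
      map_add' := fun f g => Loop.ext fun t => by
        simp only [loopOf_apply, ContinuousMap.add_apply, S₀]
        rw [← smul_add, ← intervalIntegral.integral_add (hii f _ _) (hii g _ _)]
        simp [φ]
      map_smul' := fun a f => Loop.ext fun t => by
        simp only [loopOf_apply, ContinuousMap.smul_apply, S₀, RingHom.id_apply]
        rw [smul_comm a, ← intervalIntegral.integral_smul a]
        simp only [φ, ContinuousMap.smul_apply, smul_comm a] }
  exact ⟨L.mkContinuous |μ|⁻¹ fun g => Loop.norm_le (by positivity) (hbound g), hderiv,
    fun g => Loop.norm_le (by positivity) (hbound g)⟩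

/-- The periodic solution operator of `q'' - μ² q = g`. -/
theorem exists_green [CompleteSpace F] {μ : ℝ} (hμ : 0 < μ) : ∃ Q₀ Q₁ : Loop F →L[ℝ] Loop F,
    (∀ (g : Loop F) (t : ℝ), HasDerivAt (fun t : ℝ => Q₀ g (t : UnitAddCircle))
      (Q₁ g (t : UnitAddCircle)) t) ∧
    (∀ (g : Loop F) (t : ℝ), HasDerivAt (fun t : ℝ => Q₁ g (t : UnitAddCircle))
      (g (t : UnitAddCircle) + μ ^ 2 • Q₀ g (t : UnitAddCircle)) t) ∧
    (∀ g, ‖Q₀ g‖ ≤ (μ ^ 2)⁻¹ * ‖g‖) ∧ ∀ g, ‖Q₁ g‖ ≤ μ⁻¹ * ‖g‖ := by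
  obtain ⟨S, hS, hSn⟩ := exists_green_firstOrder (F := F) hμ.ne'
  obtain ⟨R, hR, hRn⟩ := exists_green_firstOrder (F := F) (neg_ne_zero.2 hμ.ne')
  rw [abs_of_pos hμ] at hSn
  rw [abs_neg, abs_of_pos hμ] at hRn
  -- Partial fractions for D² - μ² = (D - μ)(D + μ): `R` inverts D - μ and `S` inverts D + μ.
  refine ⟨(2 * μ)⁻¹ • (R - S), (2:ℝ)⁻¹ • (R + S), fun g t => ?_, fun g t => ?_, fun g => ?_,
    fun g => ?_⟩
  · refine (((hR g t).sub (hS g t)).const_smul (2 * μ)⁻¹).congr_deriv ?_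
    simp only [smul_apply, add_apply,
      ContinuousMap.smul_apply, ContinuousMap.add_apply]
    match_scalars <;> (field_simp; try ring_nf)
  · refine (((hR g t).add (hS g t)).const_smul (2:ℝ)⁻¹).congr_deriv ?_
    simp only [smul_apply, sub_apply,
      ContinuousMap.smul_apply, ContinuousMap.sub_apply]
    match_scalars <;> (field_simp; try ring_nf)
  · simp only [smul_apply, sub_apply, norm_smul]
    calc ‖(2 * μ)⁻¹‖ * ‖R g - S g‖ ≤ ‖(2 * μ)⁻¹‖ * (μ⁻¹ * ‖g‖ + μ⁻¹ * ‖g‖) := by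
          gcongr; exact (norm_sub_le _ _).trans (add_le_add (hRn g) (hSn g))
      _ = _ := by
          rw [Real.norm_eq_abs, abs_of_pos (by positivity)]; field_simp; ring
  · simp only [smul_apply, add_apply, norm_smul]
    calc ‖(2:ℝ)⁻¹‖ * ‖R g + S g‖ ≤ ‖(2:ℝ)⁻¹‖ * (μ⁻¹ * ‖g‖ + μ⁻¹ * ‖g‖) := by
          gcongr; exact (norm_add_le _ _).trans (add_le_add (hRn g) (hSn g))
      _ = _ := by norm_num; ring

end Green

/-! ### Compact operators on loops and the Fredholm alternative -/

section Compactness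

variable {F : Type*} [NormedAddCommGroup F] [NormedSpace ℝ F] [FiniteDimensional ℝ F]

/-- A bounded operator on loops with values in loops of class `C¹`, and with bounded derivative,
is compact. -/
theorem isCompactOperator_of_hasDerivAt (S S' : Loop F →L[ℝ] Loop F)
    (hS : ∀ (g : Loop F) (t : ℝ), HasDerivAt (fun t : ℝ => S g (t : UnitAddCircle))
      (S' g (t : UnitAddCircle)) t) : IsCompactOperator S := by
  have : ProperSpace F := FiniteDimensional.proper ℝ F
  rw [isCompactOperator_iff_exists_mem_nhds_isCompact_closure_image]
  refine ⟨Metric.closedBall 0 1, Metric.closedBall_mem_nhds _ one_pos, ?_⟩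
  have hlip : ∀ g : Loop F, ‖g‖ ≤ 1 → ∀ x y : UnitAddCircle,
      ‖S g x - S g y‖ ≤ ‖S'‖ * ‖x - y‖ := by
    intro g hg x y
    obtain ⟨s, rfl⟩ := QuotientAddGroup.mk_surjective y
    obtain ⟨d, hd⟩ := QuotientAddGroup.mk_surjective (x - (s : UnitAddCircle))
    -- Subtracting the nearest integer moves along the shorter arc, whose length is the distance on
    -- the circle.
    have hd' : x - (s : UnitAddCircle) = ((d - round d : ℝ) : UnitAddCircle) := by
      have h0 : ((round d : ℝ) : UnitAddCircle) = 0 :=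
        (AddCircle.coe_eq_zero_iff 1).2 ⟨round d, by simp⟩
      rw [← hd, AddCircle.coe_sub, h0, sub_zero]
    have hx : x = ((s + (d - round d) : ℝ) : UnitAddCircle) := by
      rw [AddCircle.coe_add, ← hd']; abel
    have hnorm : ‖x - (s : UnitAddCircle)‖ = |d - round d| := by
      rw [← hd]; exact UnitAddCircle.norm_eq
    change ‖S g x - S g (s : UnitAddCircle)‖ ≤ ‖S'‖ * ‖x - (s : UnitAddCircle)‖
    rw [hnorm, hx]
    have hmv := Convex.norm_image_sub_le_of_norm_hasDerivWithin_le (s := univ) (C := ‖S'‖)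
      (f := fun t : ℝ => S g (t : UnitAddCircle)) (x := s) (y := s + (d - round d))
      (fun t _ => (hS g t).hasDerivWithinAt)
      (fun t _ => ((S' g).norm_apply_le t).trans
        ((S'.le_opNorm g).trans (mul_le_of_le_one_right (norm_nonneg _) hg))) convex_univ
      (mem_univ _) (mem_univ _)
    simpa using hmv
  let e := (ContinuousMap.isometryEquivBoundedOfCompact UnitAddCircle F).toHomeomorph
  rw [← e.isCompact_image, e.image_closure]
  refine BoundedContinuousFunction.arzela_ascoli (Metric.closedBall 0 ‖S‖)
    (isCompact_closedBall _ _) _ ?_ ?_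
  · rintro _ x ⟨_, ⟨g, hg, rfl⟩, rfl⟩
    rw [mem_closedBall_zero_iff] at hg ⊢
    exact ((S g).norm_coe_le_norm x).trans
      ((S.le_opNorm g).trans (mul_le_of_le_one_right (norm_nonneg _) hg))
  · refine Metric.equicontinuous_of_continuity_modulus (fun r => ‖S'‖ * r) ?_ _ ?_
    · simpa using (continuous_const_mul ‖S'‖).tendsto 0
    · rintro x y ⟨_, _, ⟨g, hg, rfl⟩, rfl⟩
      rw [dist_eq_norm, dist_eq_norm]
      exact hlip g (mem_closedBall_zero_iff.1 hg) x y

/-- The Fredholm alternative for compact perturbations of the identity. -/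
theorem exists_rightInverse_of_isCompactOperator {X : Type*} [NormedAddCommGroup X]
    [NormedSpace ℝ X] [CompleteSpace X] (K : X →L[ℝ] X) (hK : IsCompactOperator K)
    (hinj : ∀ u, u + K u = 0 → u = 0) : ∃ R : X →L[ℝ] X, ∀ f, R f + K (R f) = f := by
  rcases hK.hasEigenvalue_or_mem_resolventSet (μ := (-1 : ℝ)) (by norm_num) with h | h
  · obtain ⟨v, hv⟩ := h.exists_hasEigenvector
    have := hv.apply_eq_smul
    refine absurd (hinj v ?_) hv.2
    simp only [ContinuousLinearMap.coe_coe] at this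
    rw [this]; simp
  · rw [spectrum.mem_resolventSet_iff] at h
    obtain ⟨U, hU⟩ := h
    refine ⟨-(↑U⁻¹ : X →L[ℝ] X), fun f => ?_⟩
    have h1 : (U : X →L[ℝ] X) ((↑U⁻¹ : X →L[ℝ] X) f) = f := by
      rw [← mul_apply_eq_comp, Units.mul_inv]; rfl
    rw [hU] at h1
    simp only [map_neg, sub_apply, neg_apply] at h1 ⊢
    nth_rewrite 3 [← h1]
    simp [Algebra.algebraMap_eq_smul_one]
    abel
end Compactness
-- Solving the Jacobi equation modulo the velocity
section TangentialSolver

variable {F : Type*} [NormedAddCommGroup F] [InnerProductSpace ℝ F]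

/-- The action of a loop of operators on loops of vectors. -/
noncomputable def Loop.act (B : Loop (F →L[ℝ] F)) : Loop F →L[ℝ] Loop F :=
  LinearMap.mkContinuous
    { toFun := fun g => ⟨fun x => B x (g x), B.continuous.clm_apply g.continuous⟩
      map_add' := fun f g => by ext x; simp
      map_smul' := fun a f => by ext x; simp } ‖B‖ fun g =>
    Loop.norm_le (by positivity) fun t =>
      ((B t).le_opNorm _).trans (mul_le_mul (B.norm_apply_le t) (g.norm_apply_le t)
        (by positivity) (by positivity))

@[simp] theorem Loop.act_apply (B : Loop (F →L[ℝ] F)) (g : Loop F) (x : UnitAddCircle) :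
    Loop.act B g x = B x (g x) := rfl

theorem Loop.continuous_inner (z g : Loop F) :
    Continuous fun t : ℝ => ⟪z (t : UnitAddCircle), g (t : UnitAddCircle)⟫ :=
  z.continuous_lift.inner g.continuous_lift

/-- The `L²` scalar product with a loop. -/
noncomputable def Loop.pair (z : Loop F) : Loop F →L[ℝ] ℝ :=
  LinearMap.mkContinuous
    { toFun := fun g => ∫ t in (0:ℝ)..1, ⟪z (t : UnitAddCircle), g (t : UnitAddCircle)⟫
      map_add' := fun f g => by
        rw [← intervalIntegral.integral_add ((z.continuous_inner f).intervalIntegrable _ _)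
          ((z.continuous_inner g).intervalIntegrable _ _)]
        simp [inner_add_right]
      map_smul' := fun a f => by
        simp [inner_smul_right] } ‖z‖ fun g => by
    have := intervalIntegral.norm_integral_le_of_norm_le_const (a := (0:ℝ)) (b := 1)
      (C := ‖z‖ * ‖g‖) (f := fun t : ℝ => ⟪z (t : UnitAddCircle), g (t : UnitAddCircle)⟫)
      fun t _ => (norm_inner_le_norm _ _).trans
        (mul_le_mul (z.norm_apply_le t) (g.norm_apply_le t) (norm_nonneg _) (norm_nonneg _))
    simpa using this

theorem Loop.pair_apply (z g : Loop F) :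
    z.pair g = ∫ t in (0:ℝ)..1, ⟪z (t : UnitAddCircle), g (t : UnitAddCircle)⟫ := rfl

theorem Loop.pair_comm (z g : Loop F) : z.pair g = g.pair z := by
  simp only [Loop.pair_apply, real_inner_comm]

theorem Loop.pair_congr {z g z' g' : Loop F} (h : ∀ t : ℝ,
    ⟪z (t : UnitAddCircle), g (t : UnitAddCircle)⟫
      = ⟪z' (t : UnitAddCircle), g' (t : UnitAddCircle)⟫) : z.pair g = z'.pair g' := by
  simp only [Loop.pair_apply, h]

theorem Loop.pair_self_nonneg (g : Loop F) : 0 ≤ g.pair g := by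
  rw [Loop.pair_apply]
  exact intervalIntegral.integral_nonneg zero_le_one fun t _ => real_inner_self_nonneg

theorem Loop.eq_zero_of_pair_self {g : Loop F} (h : g.pair g = 0) : g = 0 := by
  rw [Loop.pair_apply] at h
  have hz : ∀ t ∈ Ico (0:ℝ) 1, g (t : UnitAddCircle) = 0 := by
    intro t ht
    by_contra hne
    have : 0 < ∫ t in (0:ℝ)..1, ⟪g (t : UnitAddCircle), g (t : UnitAddCircle)⟫ :=
      intervalIntegral.integral_pos zero_lt_one (g.continuous_inner g).continuousOn
        (fun t _ => real_inner_self_nonneg)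
        ⟨t, ⟨ht.1, ht.2.le⟩, real_inner_self_pos.2 hne⟩
    exact this.ne' h
  refine Loop.ext fun t => ?_
  obtain ⟨s, hs, hst⟩ := g.periodic_lift.exists_mem_Ico₀ zero_lt_one t
  rw [hst]
  exact hz s hs

/-- Integration by parts for loops. -/
theorem Loop.pair_deriv {p p' q q' : Loop F}
    (hp : ∀ t : ℝ, HasDerivAt (fun t : ℝ => p (t : UnitAddCircle)) (p' (t : UnitAddCircle)) t)
    (hq : ∀ t : ℝ, HasDerivAt (fun t : ℝ => q (t : UnitAddCircle)) (q' (t : UnitAddCircle)) t) :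
    p'.pair q = -p.pair q' := by
  have h := intervalIntegral.integral_eq_sub_of_hasDerivAt (a := (0:ℝ)) (b := 1)
    (fun t _ => (hp t).inner ℝ (hq t))
    (((p.continuous_inner q').add (p'.continuous_inner q)).intervalIntegrable _ _)
  rw [intervalIntegral.integral_add ((p.continuous_inner q').intervalIntegrable _ _)
    ((p'.continuous_inner q).intervalIntegrable _ _)] at h
  have h1 : ((1:ℝ) : UnitAddCircle) = ((0:ℝ) : UnitAddCircle) := by simp
  rw [h1, sub_self] at h
  rw [Loop.pair_apply, Loop.pair_apply]
  linarith

/-- If the kernel of the Jacobi operator `k ↦ P (k'' + A k)` on loops tangent along a curve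
(`N k = 0`, `P = 1 - N`) is spanned by the velocity `z`, then the Jacobi equation can be solved
modulo `z`, with bounded solution operators. -/
theorem exists_tangential_solver [FiniteDimensional ℝ F] (N N₁ N₂ A : Loop (F →L[ℝ] F))
    (z z₁ z₂ : Loop F)
    (hN₁ : ∀ t : ℝ, HasDerivAt (fun t : ℝ => N (t : UnitAddCircle)) (N₁ (t : UnitAddCircle)) t)
    (hN₂ : ∀ t : ℝ, HasDerivAt (fun t : ℝ => N₁ (t : UnitAddCircle)) (N₂ (t : UnitAddCircle)) t)
    (hNN : ∀ x v, N x (N x v) = N x v) (hNs : ∀ x v w, ⟪N x v, w⟫ = ⟪v, N x w⟫)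
    (hAs : ∀ x v w, ⟪A x v, w⟫ = ⟪v, A x w⟫)
    (hz₁ : ∀ t : ℝ, HasDerivAt (fun t : ℝ => z (t : UnitAddCircle)) (z₁ (t : UnitAddCircle)) t)
    (hz₂ : ∀ t : ℝ, HasDerivAt (fun t : ℝ => z₁ (t : UnitAddCircle)) (z₂ (t : UnitAddCircle)) t)
    (hNz : ∀ x, N x (z x) = 0)
    (hJz : ∀ x, z₂ x + A x (z x) = N x (z₂ x + A x (z x))) (hz0 : z ≠ 0)
    (hker : ∀ k k₁ k₂ : Loop F,
      (∀ t : ℝ, HasDerivAt (fun t : ℝ => k (t : UnitAddCircle)) (k₁ (t : UnitAddCircle)) t) →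
      (∀ t : ℝ, HasDerivAt (fun t : ℝ => k₁ (t : UnitAddCircle)) (k₂ (t : UnitAddCircle)) t) →
      (∀ x, N x (k x) = 0) → (∀ x, k₂ x + A x (k x) = N x (k₂ x + A x (k x))) →
      ∃ c : ℝ, k = c • z) :
    ∃ (K₀ K₁ K₂ : Loop F →L[ℝ] Loop F) (α : Loop F →L[ℝ] ℝ),
      (∀ f, ∀ t : ℝ, HasDerivAt (fun t : ℝ => K₀ f (t : UnitAddCircle))
        (K₁ f (t : UnitAddCircle)) t) ∧
      (∀ f, ∀ t : ℝ, HasDerivAt (fun t : ℝ => K₁ f (t : UnitAddCircle))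
        (K₂ f (t : UnitAddCircle)) t) ∧
      (∀ f x, N x (K₀ f x) = 0) ∧
      ∀ f x, K₂ f x + A x (K₀ f x) - N x (K₂ f x + A x (K₀ f x)) - α f • z x
        = f x - N x (f x) := by
  have := FiniteDimensional.complete ℝ F
  -- Every C² loop κ is written as `Q₀ u` with u = κ'' - κ, so that κ' = `Q₁ u` and lower order
  -- terms in κ become compact in `u`.
  obtain ⟨Q₀, Q₁, hQ₀, hQ₁, -, -⟩ := exists_green (F := F) one_pos
  simp only [one_pow, one_smul] at hQ₁
  have hc₀ : IsCompactOperator Q₀ := isCompactOperator_of_hasDerivAt Q₀ Q₁ hQ₀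
  have hc₁ : IsCompactOperator Q₁ :=
    isCompactOperator_of_hasDerivAt Q₁ (ContinuousLinearMap.id ℝ _ + Q₀) hQ₁
  -- With these coefficients, u + K u = P ((Pκ)'' + A Pκ) + N (Nκ)'' - Nκ - ⟨z, κ⟩ z, where ⟨z, κ⟩
  -- is the L² product. The Jacobi operator on the tangential part is completed by an invertible
  -- operator on the normal part and by a rank one term that removes its kernel.
  let M₁ : Loop (F →L[ℝ] F) := ((2:ℝ) • N - 1) * ((2:ℝ) • N₁)
  let M₂ : Loop (F →L[ℝ] F) := ((2:ℝ) • N - 1) * N₂ + (1 - N) * A * (1 - N) - N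
  let L₀ : Loop F →L[ℝ] Loop F :=
    ContinuousLinearMap.id ℝ _ + Loop.act M₂ - z.pair.smulRight z
  let K : Loop F →L[ℝ] Loop F := L₀ ∘L Q₀ + Loop.act M₁ ∘L Q₁
  have hK : IsCompactOperator K := by
    have h : IsCompactOperator (⇑(L₀ ∘L Q₀) + ⇑(Loop.act M₁ ∘L Q₁)) :=
      (hc₀.clm_comp L₀).add (hc₁.clm_comp (Loop.act M₁))
    exact h
  have hKapp : ∀ u x, (u + K u) x = (u x + Q₀ u x)
      + ((2:ℝ) • N x ((2:ℝ) • N₁ x (Q₁ u x) + N₂ x (Q₀ u x)) - ((2:ℝ) • N₁ x (Q₁ u x) + N₂ x (Q₀ u x)))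
      + (A x (Q₀ u x - N x (Q₀ u x)) - N x (A x (Q₀ u x - N x (Q₀ u x)))) - N x (Q₀ u x)
      - z.pair (Q₀ u) • z x := by
    intro u x
    simp only [K, L₀, M₁, M₂, ContinuousMap.add_apply, ContinuousMap.sub_apply,
      ContinuousMap.mul_apply, ContinuousMap.one_apply, ContinuousMap.smul_apply,
      ContinuousLinearMap.comp_apply, ContinuousLinearMap.id_apply, Loop.act_apply, add_apply,
      sub_apply, smul_apply, mul_apply_eq_comp, one_apply_eq_self, map_add, map_sub, map_smul,
      ContinuousLinearMap.smulRight_apply]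
    module
  -- The tangential part Pκ and its first two derivatives.
  let B₀ : Loop F →L[ℝ] Loop F := Loop.act (1 - N) ∘L Q₀
  let B₁ : Loop F →L[ℝ] Loop F := Loop.act (1 - N) ∘L Q₁ - Loop.act N₁ ∘L Q₀
  let B₂ : Loop F →L[ℝ] Loop F := Loop.act (1 - N) ∘L (ContinuousLinearMap.id ℝ _ + Q₀)
    - Loop.act ((2:ℝ) • N₁) ∘L Q₁ - Loop.act N₂ ∘L Q₀
  have hB₀ : ∀ u x, B₀ u x = Q₀ u x - N x (Q₀ u x) := fun u x => by simp [B₀]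
  have hB₁ : ∀ u x, B₁ u x = Q₁ u x - N x (Q₁ u x) - N₁ x (Q₀ u x) := fun u x => by simp [B₁]
  have hB₂ : ∀ u x, B₂ u x = (u x + Q₀ u x) - N x (u x + Q₀ u x) - (2:ℝ) • N₁ x (Q₁ u x)
      - N₂ x (Q₀ u x) := fun u x => by
    simp [B₂]
    abel
  have hd₀ : ∀ u, ∀ t : ℝ, HasDerivAt (fun t : ℝ => B₀ u (t : UnitAddCircle))
      (B₁ u (t : UnitAddCircle)) t := by
    intro u t
    simp only [hB₀, hB₁]
    refine ((hQ₀ u t).sub ((hN₁ t).clm_apply (hQ₀ u t))).congr_deriv ?_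
    abel
  have hd₁ : ∀ u, ∀ t : ℝ, HasDerivAt (fun t : ℝ => B₁ u (t : UnitAddCircle))
      (B₂ u (t : UnitAddCircle)) t := by
    intro u t
    simp only [hB₁, hB₂]
    refine (((hQ₁ u t).sub ((hN₁ t).clm_apply (hQ₁ u t))).sub
      ((hN₂ t).clm_apply (hQ₀ u t))).congr_deriv ?_
    rw [two_smul]
    abel
  have hNB : ∀ u x, N x (B₀ u x) = 0 := fun u x => by rw [hB₀, map_sub, hNN, sub_self]
  have hPB : ∀ u x, B₂ u x + A x (B₀ u x) - N x (B₂ u x + A x (B₀ u x)) - z.pair (Q₀ u) • z x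
      = (u + K u) x - N x ((u + K u) x) := by
    intro u x
    rw [hKapp, hB₂, hB₀]
    simp only [map_sub, map_add, map_smul, hNN, hNz, smul_zero]
    module
  have hinj : ∀ u, u + K u = 0 → u = 0 := by
    intro u hu
    let m : Loop F := Loop.act N (Q₀ u)
    let m₁ : Loop F := Loop.act N₁ (Q₀ u) + Loop.act N (Q₁ u)
    let m₂ : Loop F := Loop.act N₂ (Q₀ u) + Loop.act ((2:ℝ) • N₁) (Q₁ u) + Loop.act N (u + Q₀ u)
    have hm₁ : ∀ t : ℝ, HasDerivAt (fun t : ℝ => m (t : UnitAddCircle))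
        (m₁ (t : UnitAddCircle)) t := fun t => (hN₁ t).clm_apply (hQ₀ u t)
    have hm₂ : ∀ t : ℝ, HasDerivAt (fun t : ℝ => m₁ (t : UnitAddCircle))
        (m₂ (t : UnitAddCircle)) t := by
      intro t
      refine (((hN₂ t).clm_apply (hQ₀ u t)).add ((hN₁ t).clm_apply (hQ₁ u t))).congr_deriv ?_
      simp only [m₂, ContinuousMap.add_apply, Loop.act_apply, ContinuousMap.smul_apply, two_smul,
        add_apply, map_add]
      abel
    have hNm : ∀ x, N x (m₂ x) = m x := by
      intro x
      have h : N x ((u + K u) x) = 0 := by rw [hu]; simp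
      rw [hKapp] at h
      simp only [map_sub, map_add, map_smul, hNN, hNz, smul_zero] at h
      simp only [m, m₂, ContinuousMap.add_apply, Loop.act_apply,
        ContinuousMap.smul_apply, smul_apply, map_add, map_smul, hNN]
      rw [← sub_eq_zero, ← h]
      module
    -- The normal part m = Nκ satisfies N m'' = m. Pairing with m gives ∫ |m|² = -∫ |m'|².
    have hm0 : m = 0 := by
      refine Loop.eq_zero_of_pair_self (le_antisymm ?_ m.pair_self_nonneg)
      have h1 : m.pair m = m₂.pair m := Loop.pair_congr fun t => by
        rw [← hNm, hNs, hNm]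
        simp only [m, Loop.act_apply, hNN]
      rw [h1, Loop.pair_deriv hm₂ hm₁]
      linarith [m₁.pair_self_nonneg]
    have hJ : ∀ x, B₂ u x + A x (B₀ u x) - N x (B₂ u x + A x (B₀ u x))
        - z.pair (Q₀ u) • z x = 0 := by
      intro x
      rw [hPB, hu]; simp
    have hzz : z.pair z ≠ 0 := fun h => hz0 (Loop.eq_zero_of_pair_self h)
    -- The Jacobi operator is symmetric and annihilates `z`, so its range is orthogonal to `z` and
    -- the rank one term must vanish.
    have hα : z.pair (Q₀ u) = 0 := by
      have h1 : z.pair (B₂ u + Loop.act A (B₀ u)) = z.pair (z.pair (Q₀ u) • z) :=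
        Loop.pair_congr fun t => by
          have h2 := sub_eq_zero.1 (hJ t)
          simp only [ContinuousMap.add_apply, Loop.act_apply, ContinuousMap.smul_apply]
          rw [← h2, inner_sub_right, ← hNs, hNz]; simp
      have h2 : z.pair (B₂ u + Loop.act A (B₀ u)) = (z₂ + Loop.act A z).pair (B₀ u) := by
        rw [map_add, Loop.pair_comm z (B₂ u), Loop.pair_deriv (hd₁ u) hz₁,
          Loop.pair_comm (B₁ u), Loop.pair_comm (z₂ + Loop.act A z), map_add,
          Loop.pair_comm (B₀ u), Loop.pair_deriv hz₂ (hd₀ u), Loop.pair_comm (B₀ u)]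
        congr 1
        exact Loop.pair_congr fun t => (hAs _ _ _).symm
      have h3 : (z₂ + Loop.act A z).pair (B₀ u) = (0 : Loop F).pair (B₀ u) :=
        Loop.pair_congr fun t => by
          simp only [ContinuousMap.add_apply, Loop.act_apply]
          rw [hJz, hNs, hNB]; simp
      rw [h2, h3, Loop.pair_comm, map_zero, map_smul, smul_eq_mul] at h1
      exact (mul_eq_zero.1 h1.symm).resolve_right hzz
    obtain ⟨c, hc⟩ := hker (B₀ u) (B₁ u) (B₂ u) (hd₀ u) (hd₁ u) (hNB u) fun x => by
      have := hJ x
      rw [hα, zero_smul, sub_zero] at this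
      exact sub_eq_zero.1 this
    have hsplit : Q₀ u = B₀ u := by
      ext1 x
      have : m x = 0 := by rw [hm0]; rfl
      rw [hB₀, show N x (Q₀ u x) = 0 from this, sub_zero]
    -- Now κ is tangential and a multiple of `z`, yet orthogonal to `z`.
    have hκ : Q₀ u = 0 := by
      rw [hsplit, hc, map_smul, smul_eq_mul] at hα
      rw [hsplit, hc, (mul_eq_zero.1 hα).resolve_right hzz, zero_smul]
    have hκ₁ : Q₁ u = 0 := Loop.ext fun t => by
      have := hQ₀ u t
      rw [hκ] at this
      exact this.unique (hasDerivAt_const t _)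
    refine Loop.ext fun t => ?_
    have := hQ₁ u t
    rw [hκ, hκ₁] at this
    simpa using this.unique (hasDerivAt_const t _)
  obtain ⟨R, hR⟩ := exists_rightInverse_of_isCompactOperator K hK hinj
  refine ⟨B₀ ∘L R, B₁ ∘L R, B₂ ∘L R, z.pair ∘L Q₀ ∘L R, fun f => hd₀ (R f), fun f => hd₁ (R f),
    fun f => hNB (R f), fun f x => ?_⟩
  have := hPB (R f) x
  rw [hR] at this
  exact this

end TangentialSolver
variable {n : ℕ}

/-! ### Second and third derivatives of the potential -/

section Hessian

theorem two_le_smoothness : minSmoothness ℝ 2 ≤ ∞ := by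
  rw [minSmoothness_of_isRCLikeNormedField]
  exact WithTop.coe_le_coe.2 le_top

/-- The Hessian of `V` at `x`, as an operator. -/
noncomputable def hessOp (V : Euc n → ℝ) (x : Euc n) : Euc n →L[ℝ] Euc n :=
  fderiv ℝ (gradient V) x

/-- The third derivative of `V` at `x`, as a vector valued bilinear map. -/
noncomputable def thirdOp (V : Euc n → ℝ) (x : Euc n) : Euc n →L[ℝ] Euc n →L[ℝ] Euc n :=
  fderiv ℝ (hessOp V) x

/-- The Laplacian of `V`. -/
noncomputable def hessTrace (V : Euc n → ℝ) (x : Euc n) : ℝ :=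
  LinearMap.trace ℝ (Euc n) (hessOp V x)

/-- The Hessian divided by its trace; on a critical hypersurface it is the projection onto the
normal space. -/
noncomputable def normalOp (V : Euc n → ℝ) (x : Euc n) : Euc n →L[ℝ] Euc n :=
  (hessTrace V x)⁻¹ • hessOp V x

variable {V : Euc n → ℝ} (hV : ContDiff ℝ ∞ V)
include hV

theorem contDiff_gradient : ContDiff ℝ ∞ (gradient V) :=
  (InnerProductSpace.toDual ℝ (Euc n)).symm.contDiff.comp (hV.fderiv_right (by simp))

theorem contDiff_hessOp : ContDiff ℝ ∞ (hessOp V) :=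
  (contDiff_gradient hV).fderiv_right (by simp)

theorem contDiff_thirdOp : ContDiff ℝ ∞ (thirdOp V) :=
  (contDiff_hessOp hV).fderiv_right (by simp)

theorem contDiff_hessTrace : ContDiff ℝ ∞ (hessTrace V) := by
  let L : (Euc n →L[ℝ] Euc n) →L[ℝ] ℝ := LinearMap.toContinuousLinearMap
    (LinearMap.trace ℝ (Euc n) ∘ₗ ContinuousLinearMap.coeLM ℝ)
  exact L.contDiff.comp (contDiff_hessOp hV)

theorem hasFDerivAt_gradient (x : Euc n) : HasFDerivAt (gradient V) (hessOp V x) x :=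
  ((contDiff_gradient hV).differentiable (by simp) x).hasFDerivAt

theorem hasFDerivAt_hessOp (x : Euc n) : HasFDerivAt (hessOp V) (thirdOp V x) x :=
  ((contDiff_hessOp hV).differentiable (by simp) x).hasFDerivAt

theorem inner_hessOp (x v w : Euc n) : ⟪hessOp V x v, w⟫ = hess V x v w := by
  have h1 : HasFDerivAt (fun y => ⟪gradient V y, w⟫) (innerSL ℝ w ∘L hessOp V x) x := by
    refine ((innerSL ℝ w).hasFDerivAt.comp x (hasFDerivAt_gradient hV x)).congr_of_eventuallyEq
      (Eventually.of_forall fun y => ?_)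
    simp
  have h2 : HasFDerivAt (fun y => ⟪gradient V y, w⟫)
      (ContinuousLinearMap.apply ℝ ℝ w ∘L fderiv ℝ (fderiv ℝ V) x) x := by
    refine ((ContinuousLinearMap.apply ℝ ℝ w).hasFDerivAt.comp x
      ((hV.fderiv_right (m := ∞) (by simp)).differentiable (by simp) x).hasFDerivAt
      ).congr_of_eventuallyEq (Eventually.of_forall fun y => ?_)
    exact InnerProductSpace.toDual_symm_apply
  have := congrArg (fun L => L v) (h1.unique h2)
  simpa [real_inner_comm, hess] using this

theorem hessOp_symm (x v w : Euc n) : ⟪hessOp V x v, w⟫ = ⟪v, hessOp V x w⟫ := by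
  rw [real_inner_comm (hessOp V x w) v, inner_hessOp hV, inner_hessOp hV]
  exact (hV.contDiffAt.isSymmSndFDerivAt two_le_smoothness) v w

theorem thirdOp_comm (x u v : Euc n) : thirdOp V x u v = thirdOp V x v u :=
  ((contDiff_gradient hV).contDiffAt.isSymmSndFDerivAt two_le_smoothness) u v

theorem thirdOp_symm (x u v w : Euc n) : ⟪thirdOp V x u v, w⟫ = ⟪v, thirdOp V x u w⟫ := by
  have h1 : HasFDerivAt (fun y => ⟪hessOp V y v, w⟫)
      ((innerSL ℝ w ∘L (ContinuousLinearMap.apply ℝ (Euc n) v)) ∘L thirdOp V x) x := by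
    refine ((innerSL ℝ w ∘L (ContinuousLinearMap.apply ℝ (Euc n) v)).hasFDerivAt.comp x
      (hasFDerivAt_hessOp hV x)).congr_of_eventuallyEq (Eventually.of_forall fun y => ?_)
    simp [real_inner_comm]
  have h2 : HasFDerivAt (fun y => ⟪hessOp V y v, w⟫)
      ((innerSL ℝ v ∘L (ContinuousLinearMap.apply ℝ (Euc n) w)) ∘L thirdOp V x) x := by
    refine ((innerSL ℝ v ∘L (ContinuousLinearMap.apply ℝ (Euc n) w)).hasFDerivAt.comp x
      (hasFDerivAt_hessOp hV x)).congr_of_eventuallyEq (Eventually.of_forall fun y => ?_)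
    simp [hessOp_symm hV]
  have := congrArg (fun L => L u) (h1.unique h2)
  simpa [real_inner_comm] using this

end Hessian

/-! ### The tangent space of an embedded hypersurface -/

/-- The tangent space to the zero set of a submersion is the kernel of its differential. -/
theorem exists_unit_normal {M : Set (Euc n)} (hM : IsSmoothHypersurface M) {x : Euc n}
    (hx : x ∈ M) : ∃ ν : Euc n, ‖ν‖ = 1 ∧ tangentSpaceAt M x = (Submodule.span ℝ {ν})ᗮ := by
  obtain ⟨U, hU, hxU, f, hf, hf', hMU⟩ := hM x hx
  have hUx : U ∈ 𝓝 x := hU.mem_nhds hxU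
  have hfx : f x = 0 := (hMU ▸ (⟨hx, hxU⟩ : x ∈ M ∩ U) : x ∈ {y ∈ U | f y = 0}).2
  have hstrict : HasStrictFDerivAt f (fderiv ℝ f x) x :=
    (hf.contDiffAt hUx).hasStrictFDerivAt (by simp)
  set L := fderiv ℝ f x with hL
  have hL0 : L ≠ 0 := hf' x hxU
  set a := (InnerProductSpace.toDual ℝ (Euc n)).symm L with ha
  have haL : ∀ v, L v = ⟪a, v⟫ := fun v => InnerProductSpace.toDual_symm_apply.symm
  have ha0 : a ≠ 0 := fun h => hL0 (by ext v; rw [haL, h]; simp)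
  have hker : (L.ker : Submodule ℝ (Euc n)) = (Submodule.span ℝ {a})ᗮ := by
    ext v
    rw [Submodule.mem_orthogonal_singleton_iff_inner_right, ← haL]; rfl
  refine ⟨‖a‖⁻¹ • a, ?_, ?_⟩
  · rw [norm_smul, norm_inv, norm_norm, inv_mul_cancel₀ (norm_ne_zero_iff.2 ha0)]
  rw [Submodule.span_singleton_smul_eq
    (IsUnit.mk0 _ (inv_ne_zero (norm_ne_zero_iff.2 ha0))), ← hker]
  refine le_antisymm (Submodule.span_le.2 fun v hv => ?_) fun v hv => Submodule.subset_span ?_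
  -- Since `f` vanishes on `M`, its derivative within `M` can be taken to be zero, and derivatives
  -- within a set agree on the tangent cone.
  · have h0 : HasFDerivWithinAt f (0 : Euc n →L[ℝ] ℝ) M x := by
      refine (hasFDerivWithinAt_const 0 x M).congr_of_eventuallyEq ?_ hfx
      filter_upwards [self_mem_nhdsWithin, nhdsWithin_le_nhds hUx] with y hy hyU
      exact (hMU ▸ (⟨hy, hyU⟩ : y ∈ M ∩ U) : y ∈ {y ∈ U | f y = 0}).2
    exact hstrict.hasFDerivAt.hasFDerivWithinAt.unique_on h0 hv
  · have hsurj : L.range = ⊤ := by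
      rw [LinearMap.range_eq_top]
      exact LinearMap.surjective (f := (L : Euc n →ₗ[ℝ] ℝ)) fun h => hL0 (by
        ext v; exact congrArg (fun l : Euc n →ₗ[ℝ] ℝ => l v) h)
    -- Conversely, for v in the kernel, the implicit function maps the line t v to a curve in `M`
    -- through x with velocity v.
    set g := hstrict.implicitFunction f L hsurj 0 with hg
    have hgd : HasStrictFDerivAt g L.ker.subtypeL 0 := by
      have := hstrict.to_implicitFunction hsurj
      rwa [hfx] at this
    have hg0 : g 0 = x := by
      have := hstrict.implicitFunction_apply_image hsurj
      rwa [hfx] at this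
    let γ : ℝ → L.ker := fun t => t • (⟨v, hv⟩ : L.ker)
    have hγ0 : γ 0 = 0 := zero_smul ℝ _
    have hγ1 : HasDerivAt γ (⟨v, hv⟩ : L.ker) 0 := by
      have h := (hasDerivAt_id (0:ℝ)).smul_const (⟨v, hv⟩ : L.ker)
      rw [one_smul] at h
      exact h
    have hγ : Tendsto γ (𝓝[≠] 0) (𝓝 0) := by
      have h := hγ1.continuousAt.tendsto
      rw [hγ0] at h
      exact h.mono_left nhdsWithin_le_nhds
    have hgγ : Tendsto (fun t => g (γ t)) (𝓝[≠] 0) (𝓝 x) := by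
      have := hgd.hasFDerivAt.continuousAt.tendsto.comp hγ
      rwa [hg0] at this
    have hder : HasDerivAt (fun t => g (γ t)) v 0 := by
      have h2 : HasFDerivAt g L.ker.subtypeL (γ 0) := by rw [hγ0]; exact hgd.hasFDerivAt
      exact h2.comp_hasDerivAt 0 hγ1
    refine mem_tangentConeAt_of_seq (𝓝[≠] (0:ℝ)) (fun t => t⁻¹) (fun t => g (γ t) - x) ?_ ?_ ?_
    · simpa using hgγ.sub_const x
    · have hev : ∀ᶠ t in 𝓝[≠] (0:ℝ), f (g (γ t)) = 0 := by
        have h1 := hstrict.map_implicitFunction_eq hsurj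
        rw [hfx] at h1
        exact (tendsto_const_nhds.prodMk_nhds hγ : Tendsto (fun t => ((0:ℝ), γ t)) _ _).eventually h1
      filter_upwards [hev, hgγ.eventually hUx] with t ht htU
      rw [add_sub_cancel]
      exact (hMU.symm ▸ (⟨htU, ht⟩ : g (γ t) ∈ {y ∈ U | f y = 0}) : g (γ t) ∈ M ∩ U).1
    · have := hder.tendsto_slope
      refine this.congr fun t => ?_
      rw [slope_def_module, hγ0, hg0, sub_zero]

/-! ### Normal projection and second fundamental form in terms of V -/

section Hypersurface

variable {V : Euc n → ℝ} {M : Set (Euc n)} (hV : ContDiff ℝ ∞ V)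
  (hM : IsNondegenerateCriticalHypersurface V M) (hrep : IsRepulsive V M)
include hV hM

theorem mem_tangentSpaceAt_iff {x : Euc n} (hx : x ∈ M) (v : Euc n) :
    v ∈ tangentSpaceAt M x ↔ hessOp V x v = 0 := by
  rw [← hM.ker_hess x hx v]
  simp only [← inner_hessOp hV]
  exact ⟨fun h => inner_self_eq_zero.1 (h _), fun h w => by rw [h, inner_zero_left]⟩

include hrep

/-- A symmetric operator whose kernel is the hyperplane orthogonal to ν is r ν ⊗ ν, with r its
trace; repulsiveness says r < 0. Dividing by the trace thus gives the normal projection by a formula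
that is smooth in the ambient space near M, with no choice of normal field. -/
theorem hessTrace_neg_and_normalOp_eq {x : Euc n} (hx : x ∈ M) :
    hessTrace V x < 0 ∧ normalOp V x = (tangentSpaceAt M x)ᗮ.starProjection := by
  obtain ⟨ν, hν, hT⟩ := exists_unit_normal hM.smooth hx
  have hTo : (tangentSpaceAt M x)ᗮ = Submodule.span ℝ {ν} := by
    rw [hT, Submodule.orthogonal_orthogonal]
  have hνν : ⟪ν, ν⟫ = 1 := by rw [real_inner_self_eq_norm_sq, hν]; norm_num
  set r := hess V x ν ν with hr
  have hr0 : r < 0 := hrep x hx ν (hTo ▸ Submodule.mem_span_singleton_self ν) hν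
  have hop : ∀ v, hessOp V x v = (r * ⟪ν, v⟫) • ν := by
    have htan : ∀ v, hessOp V x (v - ⟪ν, v⟫ • ν) = 0 := fun v => by
      rw [← mem_tangentSpaceAt_iff hV hM hx, hT,
        Submodule.mem_orthogonal_singleton_iff_inner_right, inner_sub_right, inner_smul_right,
        hνν, mul_one, sub_self]
    have hν' : hessOp V x ν = r • ν := by
      refine ext_inner_right ℝ fun w => ?_
      have h1 := htan w
      rw [map_sub, map_smul, sub_eq_zero] at h1
      rw [hessOp_symm hV, h1, inner_smul_right, inner_smul_left, ← hessOp_symm hV,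
        inner_hessOp hV]
      simp [hr, mul_comm]
    intro v
    have h1 := htan v
    rw [map_sub, map_smul, sub_eq_zero, hν', smul_smul, mul_comm] at h1
    exact h1
  have htr : hessTrace V x = r := by
    have : hessOp V x = r • InnerProductSpace.rankOne ℝ ν ν := by
      ext1 v
      rw [hop]
      simp [smul_smul]
    rw [hessTrace, this]
    simp [InnerProductSpace.trace_rankOne, hν]
  refine ⟨htr ▸ hr0, ?_⟩
  ext1 v
  have hproj : (tangentSpaceAt M x)ᗮ.starProjection v = ⟪ν, v⟫ • ν := by
    simp only [hTo]
    exact Submodule.starProjection_unit_singleton ℝ hν v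
  rw [hproj, normalOp, htr, smul_apply, hop, smul_smul,
    ← mul_assoc, inv_mul_cancel₀ hr0.ne, one_mul]

theorem hessTrace_neg {x : Euc n} (hx : x ∈ M) : hessTrace V x < 0 :=
  (hessTrace_neg_and_normalOp_eq hV hM hrep hx).1

theorem normalOp_eq {x : Euc n} (hx : x ∈ M) :
    normalOp V x = (tangentSpaceAt M x)ᗮ.starProjection :=
  (hessTrace_neg_and_normalOp_eq hV hM hrep hx).2

theorem hessOp_eq {x : Euc n} (hx : x ∈ M) : hessOp V x = hessTrace V x • normalOp V x := by
  rw [normalOp, smul_smul, mul_inv_cancel₀ (hessTrace_neg hV hM hrep hx).ne, one_smul]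

theorem normalOp_idem {x : Euc n} (hx : x ∈ M) (v : Euc n) :
    normalOp V x (normalOp V x v) = normalOp V x v := by
  rw [normalOp_eq hV hM hrep hx]
  exact Submodule.starProjection_eq_self_iff.2 (Submodule.starProjection_apply_mem _ _)

omit hM hrep in
theorem normalOp_symm (x v w : Euc n) :
    ⟪normalOp V x v, w⟫ = ⟪v, normalOp V x w⟫ := by
  simp only [normalOp, smul_apply, inner_smul_left, inner_smul_right, hessOp_symm hV]
  simp

theorem starProjection_tangentSpaceAt {x : Euc n} (hx : x ∈ M) (v : Euc n) :
    (tangentSpaceAt M x).starProjection v = v - normalOp V x v := by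
  rw [normalOp_eq hV hM hrep hx, Submodule.starProjection_orthogonal_val]
  abel

theorem mem_tangentSpaceAt_iff_normalOp {x : Euc n} (hx : x ∈ M) (v : Euc n) :
    v ∈ tangentSpaceAt M x ↔ normalOp V x v = 0 := by
  rw [mem_tangentSpaceAt_iff hV hM hx, normalOp, smul_apply,
    smul_eq_zero_iff_right (inv_ne_zero (hessTrace_neg hV hM hrep hx).ne)]

omit hV hM hrep in
-- Derivatives within M are unique only on the tangent cone, hence by linearity on its span;
-- identities valid on M may be differentiated in these directions.
theorem eq_on_tangentSpaceAt_of_hasFDerivWithinAt {G : Type*} [NormedAddCommGroup G]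
    [NormedSpace ℝ G] {x : Euc n} {f : Euc n → G} {f₁ f₂ : Euc n →L[ℝ] G}
    (h₁ : HasFDerivWithinAt f f₁ M x) (h₂ : HasFDerivWithinAt f f₂ M x) {v : Euc n}
    (hv : v ∈ tangentSpaceAt M x) : f₁ v = f₂ v :=
  LinearMap.eqOn_span (f := (f₁ : Euc n →ₗ[ℝ] G)) (g := (f₂ : Euc n →ₗ[ℝ] G))
    (h₁.unique_on h₂) hv

/-- The third derivative of `V` vanishes on tangent vectors. -/
theorem inner_thirdOp_eq_zero {x : Euc n} (hx : x ∈ M) {u v w : Euc n}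
    (hu : u ∈ tangentSpaceAt M x) (hv : v ∈ tangentSpaceAt M x) (hw : w ∈ tangentSpaceAt M x) :
    ⟪thirdOp V x u v, w⟫ = 0 := by
  -- On M one has H² = (tr H) H for the Hessian H. Differentiating along u, applying to v and
  -- pairing with w, all terms containing H v or H w vanish, which leaves -(tr H) ⟨V'''[u, v], w⟩ =
  -- 0.
  let f : Euc n → Euc n := fun y => hessOp V y (hessOp V y v) - hessTrace V y • hessOp V y v
  have hH := hasFDerivAt_hessOp hV x
  have htr : HasFDerivAt (hessTrace V) (fderiv ℝ (hessTrace V) x) x :=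
    ((contDiff_hessTrace hV).differentiable (by simp) x).hasFDerivAt
  have hHv := hH.clm_apply (hasFDerivAt_const v x)
  have hf := ((hH.clm_apply hHv).sub (htr.smul hHv)).hasFDerivWithinAt (s := M)
  have hf0 : HasFDerivWithinAt f (0 : Euc n →L[ℝ] Euc n) M x := by
    have h0 : ∀ y ∈ M, f y = 0 := by
      intro y hy
      simp only [f]
      conv_lhs => enter [1]; rw [hessOp_eq hV hM hrep hy]
      conv_lhs => enter [2]; rw [hessOp_eq hV hM hrep hy]
      simp only [smul_apply, map_smul, normalOp_idem hV hM hrep hy, sub_self]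
    exact (hasFDerivWithinAt_const 0 x M).congr h0 (h0 x hx)
  have hHvx := (mem_tangentSpaceAt_iff hV hM hx v).1 hv
  have hHwx := (mem_tangentSpaceAt_iff hV hM hx w).1 hw
  have key := eq_on_tangentSpaceAt_of_hasFDerivWithinAt hf hf0 hu
  simp [hHvx] at key
  have h2 := congrArg (fun y => ⟪y, w⟫) key
  simp only [inner_sub_left, hessOp_symm hV, hHwx, inner_smul_left, inner_zero_right,
    inner_zero_left, zero_sub, neg_eq_zero, mul_eq_zero] at h2
  exact h2.resolve_left (by simpa using (hessTrace_neg hV hM hrep hx).ne)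

/-- This keeps the leading quadratic term of the expansion out of the tangential equation. -/
theorem normalOp_thirdOp {x : Euc n} (hx : x ∈ M) {u v : Euc n}
    (hu : u ∈ tangentSpaceAt M x) (hv : v ∈ tangentSpaceAt M x) :
    normalOp V x (thirdOp V x u v) = thirdOp V x u v := by
  rw [normalOp_eq hV hM hrep hx, Submodule.starProjection_eq_self_iff]
  exact fun w hw => by
    rw [real_inner_comm]; exact inner_thirdOp_eq_zero hV hM hrep hx hu hv hw

theorem contDiffAt_normalOp {x : Euc n} (hx : x ∈ M) : ContDiffAt ℝ ∞ (normalOp V) x :=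
  ((contDiff_hessTrace hV).contDiffAt.inv (hessTrace_neg hV hM hrep hx).ne).smul
    (contDiff_hessOp hV).contDiffAt

/-- On M the tangent extension of w is w - N w, with derivative -(D_v N) w. Differentiating H = (tr
H) N and using N w = 0 gives V'''[v, w] = (tr H) (D_v N) w. -/
theorem secondFundamentalForm_eq {x : Euc n} (hx : x ∈ M) {v w : Euc n}
    (hv : v ∈ tangentSpaceAt M x) (hw : w ∈ tangentSpaceAt M x) :
    secondFundamentalForm M x v w = -((hessTrace V x)⁻¹ • thirdOp V x v w) := by
  have htx := (hessTrace_neg hV hM hrep hx).ne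
  have hN : HasFDerivAt (normalOp V) (fderiv ℝ (normalOp V) x) x :=
    ((contDiffAt_normalOp hV hM hrep hx).differentiableAt (by simp)).hasFDerivAt
  have htr : HasFDerivAt (hessTrace V) (fderiv ℝ (hessTrace V) x) x :=
    ((contDiff_hessTrace hV).differentiable (by simp) x).hasFDerivAt
  have hNw : normalOp V x w = 0 := (mem_tangentSpaceAt_iff_normalOp hV hM hrep hx w).1 hw
  have h1 : thirdOp V x v w = hessTrace V x • fderiv ℝ (normalOp V) x v w := by
    have hev : hessOp V =ᶠ[𝓝 x] fun y => hessTrace V y • normalOp V y := by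
      filter_upwards [(contDiff_hessTrace hV).continuous.continuousAt.eventually_ne htx] with y hy
      rw [normalOp, smul_smul, mul_inv_cancel₀ hy, one_smul]
    have := (hasFDerivAt_hessOp hV x).unique ((htr.smul hN).congr_of_eventuallyEq hev)
    rw [this]
    simp [hNw]
  let f : Euc n → Euc n := fun y => (tangentSpaceAt M y).starProjection w
  have hf : HasFDerivWithinAt f
      (-((ContinuousLinearMap.apply ℝ (Euc n) w) ∘L fderiv ℝ (normalOp V) x)) M x := by
    have h2 : HasFDerivAt (fun y => w - normalOp V y w)
        (-((ContinuousLinearMap.apply ℝ (Euc n) w) ∘L fderiv ℝ (normalOp V) x)) x :=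
      ((ContinuousLinearMap.apply ℝ (Euc n) w).hasFDerivAt.comp x hN).const_sub w
    exact h2.hasFDerivWithinAt.congr
      (fun y hy => starProjection_tangentSpaceAt hV hM hrep hy w)
      (starProjection_tangentSpaceAt hV hM hrep hx w)
  have h3 : fderivWithin ℝ f M x v = -(fderiv ℝ (normalOp V) x v w) :=
    eq_on_tangentSpaceAt_of_hasFDerivWithinAt hf.differentiableWithinAt.hasFDerivWithinAt hf hv
  rw [secondFundamentalForm, ← normalOp_eq hV hM hrep hx, h3]
  have h4 : fderiv ℝ (normalOp V) x v w = (hessTrace V x)⁻¹ • thirdOp V x v w := by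
    rw [h1, smul_smul, inv_mul_cancel₀ htx, one_smul]
  rw [h4, map_neg, map_smul, normalOp_thirdOp hV hM hrep hx hv hw]

end Hypersurface
-- H¹ loops and integration by parts
/-- Integration by parts against the primitive of an integrable function. -/
theorem integral_mul_eq_neg_of_primitive {f f' g : ℝ → ℝ} (c : ℝ)
    (hf : ∀ t, HasDerivAt f (f' t) t) (hf' : Continuous f')
    (hg : IntervalIntegrable g volume 0 1) (hf01 : f 1 = f 0) (hg0 : ∫ t in (0:ℝ)..1, g t = 0) :
    ∫ t in (0:ℝ)..1, f t * g t = -∫ t in (0:ℝ)..1, f' t * (c + ∫ s in (0:ℝ)..t, g s) := by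
  have hdf : deriv f = f' := funext fun t => (hf t).deriv
  have hfC : ContDiff ℝ 1 f := contDiff_one_iff_deriv.2
    ⟨fun t => (hf t).differentiableAt, hdf ▸ hf'⟩
  have hfac : AbsolutelyContinuousOnInterval f 0 1 :=
    hfC.contDiffOn.absolutelyContinuousOnInterval
  have hgac : AbsolutelyContinuousOnInterval (fun t => c + ∫ s in (0:ℝ)..t, g s) 0 1 :=
    (contDiff_const (c := c)).contDiffOn.absolutelyContinuousOnInterval.add
      (hg.absolutelyContinuousOnInterval_intervalIntegral (by simp))
  have h := hfac.integral_mul_deriv_eq_deriv_mul hgac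
  rw [hdf, hg0, hf01] at h
  simp only [intervalIntegral.integral_same, add_zero, sub_self, zero_sub] at h
  rw [← h]
  refine intervalIntegral.integral_congr_ae ?_
  filter_upwards [hg.ae_hasDerivAt_integral] with t ht htm
  have := (ht (uIoc_subset_uIcc htm) 0 (by simp)).const_add c
  rw [this.deriv]

theorem IsH1Loop.of_hasDerivAt {k k' : ℝ → Euc n} (hp : Function.Periodic k 1)
    (hk : ∀ t, HasDerivAt k (k' t) t) (hk' : Continuous k') : IsH1Loop k := by
  refine ⟨hp, k', ?_, fun t _ => ?_⟩
  · obtain ⟨C, hC⟩ := isCompact_Icc.exists_bound_of_continuousOn (s := Icc (0:ℝ) 1)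
      hk'.continuousOn
    exact MemLp.of_bound hk'.aestronglyMeasurable C
      ((ae_restrict_mem measurableSet_Icc).mono hC)
  · rw [intervalIntegral.integral_eq_sub_of_hasDerivAt (fun s _ => hk s)
      (hk'.intervalIntegrable _ _)]
    abel

/-- An `H¹` loop is almost everywhere differentiable, with integrable derivative, and can be
integrated by parts against a loop of class `C¹`. -/
theorem IsH1Loop.integral_inner {w : ℝ → Euc n} (hw : IsH1Loop w) :
    ContinuousOn w (uIcc 0 1) ∧ ∃ g : ℝ → Euc n,
      (∀ p : ℝ → Euc n, Continuous p → IntervalIntegrable (fun t => ⟪p t, g t⟫) volume 0 1) ∧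
      (∀ᵐ t, t ∈ uIoc (0:ℝ) 1 → HasDerivAt w (g t) t) ∧
      ∀ p p' : ℝ → Euc n, (∀ t, HasDerivAt p (p' t) t) → Continuous p' → p 1 = p 0 →
        ∫ t in (0:ℝ)..1, ⟪p t, g t⟫ = -∫ t in (0:ℝ)..1, ⟪p' t, w t⟫ := by
  obtain ⟨hp, g, hgm, hg⟩ := hw
  have hgi : IntervalIntegrable g volume 0 1 := by
    rw [intervalIntegrable_iff_integrableOn_Icc_of_le zero_le_one]
    exact hgm.integrable (by norm_num)
  have hwc : ContinuousOn w (uIcc 0 1) := by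
    have h1 : ContinuousOn (fun t => w 0 + ∫ s in (0:ℝ)..t, g s) (uIcc 0 1) :=
      continuousOn_const.add (intervalIntegral.continuousOn_primitive_interval
        (by rw [uIcc_of_le zero_le_one]; exact hgm.integrable (by norm_num)))
    refine h1.congr fun t ht => ?_
    rw [uIcc_of_le zero_le_one] at ht
    exact hg t ht
  have hgi' : ∀ i, IntervalIntegrable (fun t => g t i) volume 0 1 := fun i =>
    ⟨(EuclideanSpace.proj (𝕜 := ℝ) i).integrable_comp hgi.1,
      (EuclideanSpace.proj (𝕜 := ℝ) i).integrable_comp hgi.2⟩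
  have hci : ∀ {q : ℝ → Euc n}, Continuous q → ∀ i, Continuous fun t => q t i := fun hq i =>
    (EuclideanSpace.proj (𝕜 := ℝ) i).continuous.comp hq
  have hsum : ∀ v w : Euc n, ⟪v, w⟫ = ∑ i, v i * w i := fun v w => by
    simp [PiLp.inner_apply, mul_comm]
  refine ⟨hwc, g, fun p hpc => ?_, ?_, ?_⟩
  · simp only [hsum]
    have := IntervalIntegrable.sum (μ := volume) (a := 0) (b := 1) Finset.univ
      (f := fun i t => p t i * g t i) fun i _ => (hgi' i).continuousOn_mul (hci hpc i).continuousOn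
    simpa [Finset.sum_fn] using this
  -- The primitive formula holds only on [0, 1], so the endpoint is discarded to have a two-sided
  -- neighbourhood.
  · have h1 : ∀ᵐ t : ℝ, t ≠ 1 := by simp [ae_iff, measure_singleton]
    filter_upwards [hgi.ae_hasDerivAt_integral, h1] with t ht ht1 htm
    rw [uIoc_of_le zero_le_one] at htm
    have htI : t ∈ Ioo (0:ℝ) 1 := ⟨htm.1, lt_of_le_of_ne htm.2 ht1⟩
    have h2 := (ht (by rw [uIcc_of_le zero_le_one]; exact Ioc_subset_Icc_self htm) 0
      (by simp)).const_add (w 0)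
    refine h2.congr_of_eventuallyEq ?_
    filter_upwards [isOpen_Ioo.mem_nhds htI] with s hs
    exact hg s (Ioo_subset_Icc_self hs)
  · intro p p' hpd hpc hp01
    -- Periodicity of `w` forces its derivative to have mean zero.
    have hg0 : ∫ t in (0:ℝ)..1, g t = 0 := by
      have h1 := hg 1 (by simp)
      have h2 : w 1 = w 0 := by simpa using hp 0
      rw [h2] at h1
      simpa using h1.symm
    have hint : ∀ i, ∀ t ∈ Icc (0:ℝ) 1, ∫ s in (0:ℝ)..t, g s i = (∫ s in (0:ℝ)..t, g s) i := by
      intro i t ht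
      refine (EuclideanSpace.proj (𝕜 := ℝ) i).intervalIntegral_comp_comm (hgi.mono_set ?_)
      rw [uIcc_of_le ht.1, uIcc_of_le zero_le_one]
      exact Icc_subset_Icc_right ht.2
    have hpi : ∀ i t, HasDerivAt (fun t => p t i) (p' t i) t := fun i t =>
      (EuclideanSpace.proj (𝕜 := ℝ) i).hasFDerivAt.comp_hasDerivAt t (hpd t)
    have hpc0 : Continuous p := continuous_iff_continuousAt.2 fun t => (hpd t).continuousAt
    have hcoord : ∀ i, ∫ t in (0:ℝ)..1, p t i * g t i = -∫ t in (0:ℝ)..1, p' t i * w t i := by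
      intro i
      rw [integral_mul_eq_neg_of_primitive (w 0 i) (hpi i) (hci hpc i) (hgi' i) (by rw [hp01])
        (by rw [hint i 1 (by simp), hg0]; rfl)]
      congr 1
      refine intervalIntegral.integral_congr fun t ht => ?_
      rw [uIcc_of_le zero_le_one] at ht
      simp only
      rw [hint i t ht, hg t ht]
      rfl
    simp only [hsum]
    rw [intervalIntegral.integral_finsetSum, intervalIntegral.integral_finsetSum,
      ← Finset.sum_neg_distrib]
    · exact Finset.sum_congr rfl fun i _ => hcoord i
    · intro i _
      refine ContinuousOn.intervalIntegrable ((hci hpc i).continuousOn.mul ?_)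
      exact (EuclideanSpace.proj (𝕜 := ℝ) i).continuous.comp_continuousOn hwc
    · intro i _
      exact (hgi' i).continuousOn_mul (hci hpc0 i).continuousOn

/-! ### Jacobi fields along a closed geodesic -/

/-- The normal correction `y` along a curve `h`, which solves `V''(h) y + h'' = 0` if `h` is a
geodesic. -/
noncomputable def normalCorrection (V : Euc n → ℝ) (h : ℝ → Euc n) (t : ℝ) : Euc n :=
  -((hessTrace V (h t))⁻¹ • deriv (deriv h) t)

/-- The potential `V'''(h)[y]` of the Jacobi operator `k ↦ P (k'' + V'''(h)[y, k])` along a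
curve `h`. -/
noncomputable def jacobiPotential (V : Euc n → ℝ) (h : ℝ → Euc n) (t : ℝ) :
    Euc n →L[ℝ] Euc n :=
  thirdOp V (h t) (normalCorrection V h t)

theorem contDiff_deriv_infty {F : Type*} [NormedAddCommGroup F] [NormedSpace ℝ F] {f : ℝ → F}
    (hf : ContDiff ℝ ∞ f) : ContDiff ℝ ∞ (deriv f) :=
  (contDiff_infty_iff_deriv.1 hf).2

theorem hasDerivAt_of_contDiff_infty {F : Type*} [NormedAddCommGroup F] [NormedSpace ℝ F]
    {f : ℝ → F} (hf : ContDiff ℝ ∞ f) (t : ℝ) : HasDerivAt f (deriv f t) t :=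
  (hf.differentiable (by simp) t).hasDerivAt

theorem periodic_deriv {F : Type*} [NormedAddCommGroup F] [NormedSpace ℝ F]
    {f : ℝ → F} {c : ℝ} (hf : Function.Periodic f c) : Function.Periodic (deriv f) c := by
  intro t
  rw [← deriv_comp_add_const, funext hf]

section Curve

variable {V : Euc n → ℝ} {M : Set (Euc n)} {h : ℝ → Euc n} (hV : ContDiff ℝ ∞ V)
  (hM : IsNondegenerateCriticalHypersurface V M) (hrep : IsRepulsive V M)
  (hh : IsClosedGeodesic M h)
include hV hM hrep hh

theorem contDiff_normalOp_comp : ContDiff ℝ ∞ fun t => normalOp V (h t) :=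
  contDiff_iff_contDiffAt.2 fun t =>
    (contDiffAt_normalOp hV hM hrep (hh.mem t)).comp t hh.smooth.contDiffAt

theorem contDiff_normalCorrection : ContDiff ℝ ∞ (normalCorrection V h) :=
  ((((contDiff_hessTrace hV).comp hh.smooth).inv
    fun t => (hessTrace_neg hV hM hrep (hh.mem t)).ne).smul
      (contDiff_deriv_infty (contDiff_deriv_infty hh.smooth))).neg

omit hV hM hrep in
theorem periodic_normalCorrection : Function.Periodic (normalCorrection V h) 1 := by
  intro t
  simp only [normalCorrection, hh.periodic t, periodic_deriv (periodic_deriv hh.periodic) t]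

theorem contDiff_jacobiPotential : ContDiff ℝ ∞ (jacobiPotential V h) :=
  ((contDiff_thirdOp hV).comp hh.smooth).clm_apply (contDiff_normalCorrection hV hM hrep hh)

omit hV hM hrep in
theorem periodic_jacobiPotential : Function.Periodic (jacobiPotential V h) 1 := by
  intro t
  simp only [jacobiPotential, hh.periodic t, periodic_normalCorrection hh t]

omit hM hrep hh in
theorem hasDerivAt_hessOp_apply (hs : ContDiff ℝ ∞ h) {k : ℝ → Euc n} {k' : Euc n} {t : ℝ}
    (hk : HasDerivAt k k' t) : HasDerivAt (fun t => hessOp V (h t) (k t))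
      (thirdOp V (h t) (deriv h t) (k t) + hessOp V (h t) k') t :=
  ((hasFDerivAt_hessOp hV (h t)).comp_hasDerivAt t (hasDerivAt_of_contDiff_infty hs t)).clm_apply hk

omit hrep in
theorem hessOp_deriv (t : ℝ) : hessOp V (h t) (deriv h t) = 0 := by
  have h1 := (hasFDerivAt_gradient hV (h t)).comp_hasDerivAt t
    (hasDerivAt_of_contDiff_infty hh.smooth t)
  have h2 : gradient V ∘ h = fun _ => 0 := funext fun s => hM.critical _ (hh.mem s)
  rw [h2] at h1
  exact h1.unique (hasDerivAt_const t 0)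

omit hrep in
theorem deriv_mem_tangentSpaceAt (t : ℝ) : deriv h t ∈ tangentSpaceAt M (h t) :=
  (mem_tangentSpaceAt_iff hV hM (hh.mem t) _).2 (hessOp_deriv hV hM hh t)

theorem normalOp_deriv_deriv (t : ℝ) :
    normalOp V (h t) (deriv (deriv h) t) = deriv (deriv h) t := by
  have h1 := hh.geodesic t
  rw [covDeriv, starProjection_tangentSpaceAt hV hM hrep (hh.mem t), sub_eq_zero] at h1
  exact h1.symm

/-- The acceleration of a geodesic is normal, and there the Hessian is multiplication by its trace.
This identity cancels the terms of order δ⁰ in v'' + δ⁻⁶ V'(v). -/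
theorem hessOp_normalCorrection (t : ℝ) :
    hessOp V (h t) (normalCorrection V h t) = -deriv (deriv h) t := by
  rw [normalCorrection, map_neg, map_smul, hessOp_eq hV hM hrep (hh.mem t), smul_apply,
    normalOp_deriv_deriv hV hM hrep hh, smul_smul,
    inv_mul_cancel₀ (hessTrace_neg hV hM hrep (hh.mem t)).ne, one_smul]

/-- The velocity of a geodesic is a Jacobi field. -/
theorem jacobi_deriv (t : ℝ) :
    deriv (deriv (deriv h)) t + jacobiPotential V h t (deriv h t)
      = normalOp V (h t) (deriv (deriv (deriv h)) t + jacobiPotential V h t (deriv h t)) := by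
  -- Differentiate V''(h) y = -h''. The only term outside the Jacobi expression is V''(h) y', which
  -- is normal.
  have h1 := hasDerivAt_hessOp_apply hV hh.smooth
    (hasDerivAt_of_contDiff_infty (contDiff_normalCorrection hV hM hrep hh) t)
  have h2 : (fun t => hessOp V (h t) (normalCorrection V h t)) = fun t => -deriv (deriv h) t :=
    funext (hessOp_normalCorrection hV hM hrep hh)
  rw [h2] at h1
  have h3 := h1.unique (hasDerivAt_of_contDiff_infty
    (contDiff_deriv_infty (contDiff_deriv_infty hh.smooth)) t).neg
  have h4 : deriv (deriv (deriv h)) t + jacobiPotential V h t (deriv h t)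
      = -hessOp V (h t) (deriv (normalCorrection V h) t) := by
    rw [jacobiPotential, thirdOp_comm hV, eq_neg_iff_add_eq_zero, add_assoc, h3]
    abel
  rw [h4, map_neg, hessOp_eq hV hM hrep (hh.mem t), smul_apply, map_smul,
    normalOp_idem hV hM hrep (hh.mem t)]

/-- The normal part of the derivative of a tangent field is the second fundamental form. -/
theorem normalOp_deriv_tangent {k : ℝ → Euc n} {k' : Euc n} {t : ℝ}
    (hT : ∀ t, k t ∈ tangentSpaceAt M (h t)) (hk : HasDerivAt k k' t) :
    normalOp V (h t) k' = secondFundamentalForm M (h t) (deriv h t) (k t) := by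
  -- Differentiate V''(h) k = 0, which expresses that k is tangent.
  have h1 := hasDerivAt_hessOp_apply hV hh.smooth hk
  have h2 : (fun t => hessOp V (h t) (k t)) = fun _ => 0 :=
    funext fun s => (mem_tangentSpaceAt_iff hV hM (hh.mem s) _).1 (hT s)
  rw [h2] at h1
  have h3 := h1.unique (hasDerivAt_const t 0)
  rw [secondFundamentalForm_eq hV hM hrep (hh.mem t) (deriv_mem_tangentSpaceAt hV hM hh t) (hT t),
    ← smul_neg, ← eq_neg_of_add_eq_zero_right h3, normalOp, smul_apply]

/-- The Gauss equations turn the integrand of the second variation into an expression in terms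
of the third derivative of `V`. -/
theorem inner_covDeriv_sub_riemann {k w : ℝ → Euc n} {k' w' : Euc n} {t : ℝ}
    (hkT : ∀ t, k t ∈ tangentSpaceAt M (h t)) (hk : HasDerivAt k k' t)
    (hwT : ∀ t, w t ∈ tangentSpaceAt M (h t)) (hw : HasDerivAt w w' t) :
    ⟪covDeriv M h k t, covDeriv M h w t⟫ = ⟪k', w'⟫ - ⟪normalOp V (h t) k', w'⟫ ∧
    riemann M (h t) (k t) (deriv h t) (deriv h t) (w t)
      = ⟪jacobiPotential V h t (k t), w t⟫ - ⟪normalOp V (h t) k', w'⟫ := by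
  have hx := hh.mem t
  have hd := deriv_mem_tangentSpaceAt hV hM hh
  constructor
  · rw [covDeriv, covDeriv, hk.deriv, hw.deriv, starProjection_tangentSpaceAt hV hM hrep hx,
      starProjection_tangentSpaceAt hV hM hrep hx, inner_sub_left, inner_sub_right,
      inner_sub_right, ← normalOp_symm hV, ← normalOp_symm hV, normalOp_idem hV hM hrep hx]
    ring
  -- In the Gauss equations the product of II(h', h') = h'' with II(k, w) gives the potential, and
  -- the product of II(k, h') = N k' with II(h', w) = N w' gives the term that also appears in the
  -- covariant derivatives.
  · have e1 : secondFundamentalForm M (h t) (deriv h t) (deriv h t) = deriv (deriv h) t := by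
      rw [← normalOp_deriv_tangent hV hM hrep hh hd
        (hasDerivAt_of_contDiff_infty (contDiff_deriv_infty hh.smooth) t),
        normalOp_deriv_deriv hV hM hrep hh]
    have e2 : secondFundamentalForm M (h t) (k t) (deriv h t) = normalOp V (h t) k' := by
      rw [normalOp_deriv_tangent hV hM hrep hh hkT hk,
        secondFundamentalForm_eq hV hM hrep hx (hkT t) (hd t),
        secondFundamentalForm_eq hV hM hrep hx (hd t) (hkT t), thirdOp_comm hV]
    have e3 : ⟪jacobiPotential V h t (k t), w t⟫
        = -⟪deriv (deriv h) t, (hessTrace V (h t))⁻¹ • thirdOp V (h t) (k t) (w t)⟫ := by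
      rw [jacobiPotential, thirdOp_comm hV, thirdOp_symm hV, normalCorrection, inner_neg_left,
        real_inner_smul_left, real_inner_smul_right]
    rw [riemann, e1, e2, ← normalOp_deriv_tangent hV hM hrep hh hwT hw,
      secondFundamentalForm_eq hV hM hrep hx (hkT t) (hwT t), ← normalOp_symm hV,
      normalOp_idem hV hM hrep hx, e3, inner_neg_right]

/-- The terms ⟨N k', w'⟩ cancel, so the second variation is ∫ ⟨k', w'⟩ - ∫ ⟨A k, w⟩ with A the
Jacobi potential. After integration by parts it pairs the normal vector k'' + A k with the tangent
vector w. Test fields are only H¹, so w' exists almost everywhere. -/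
theorem mem_secondVariationKernel {k k' k'' : ℝ → Euc n} (hp : Function.Periodic k 1)
    (hp' : Function.Periodic k' 1) (hk : ∀ t, HasDerivAt k (k' t) t)
    (hk' : ∀ t, HasDerivAt k' (k'' t) t) (hk'' : Continuous k'')
    (hT : ∀ t, k t ∈ tangentSpaceAt M (h t))
    (hJ : ∀ t, k'' t + jacobiPotential V h t (k t)
      = normalOp V (h t) (k'' t + jacobiPotential V h t (k t))) :
    k ∈ secondVariationKernel M h := by
  have hk'c : Continuous k' := continuous_iff_continuousAt.2 fun t => (hk' t).continuousAt
  have hkc : Continuous k := continuous_iff_continuousAt.2 fun t => (hk t).continuousAt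
  refine ⟨⟨IsH1Loop.of_hasDerivAt hp hk hk'c, hT⟩, fun w hw => ?_⟩
  obtain ⟨hwc, g, hinner, hwd, hparts⟩ := hw.1.integral_inner
  have hNc : Continuous fun t => normalOp V (h t) :=
    (contDiff_normalOp_comp hV hM hrep hh).continuous
  have hAc : Continuous (jacobiPotential V h) := (contDiff_jacobiPotential hV hM hrep hh).continuous
  have hinnerw : ∀ {p : ℝ → Euc n}, Continuous p →
      IntervalIntegrable (fun t => ⟪p t, w t⟫) volume 0 1 := fun hpc =>
    (hpc.continuousOn.inner hwc).intervalIntegrable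
  have i1 : ∫ t in (0:ℝ)..1, ⟪covDeriv M h k t, covDeriv M h w t⟫
      = ∫ t in (0:ℝ)..1, (⟪k' t, g t⟫ - ⟪normalOp V (h t) (k' t), g t⟫) := by
    refine intervalIntegral.integral_congr_ae ?_
    filter_upwards [hwd] with t ht htm
    exact (inner_covDeriv_sub_riemann hV hM hrep hh hT (hk t) hw.2 (ht htm)).1
  have i2 : ∫ t in (0:ℝ)..1, riemann M (h t) (k t) (deriv h t) (deriv h t) (w t)
      = ∫ t in (0:ℝ)..1, (⟪jacobiPotential V h t (k t), w t⟫
        - ⟪normalOp V (h t) (k' t), g t⟫) := by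
    refine intervalIntegral.integral_congr_ae ?_
    filter_upwards [hwd] with t ht htm
    exact (inner_covDeriv_sub_riemann hV hM hrep hh hT (hk t) hw.2 (ht htm)).2
  rw [secondVariation, i1, i2, intervalIntegral.integral_sub (hinner _ hk'c)
    (hinner _ (hNc.clm_apply hk'c)), intervalIntegral.integral_sub
    (hinnerw (hAc.clm_apply hkc)) (hinner _ (hNc.clm_apply hk'c)), sub_sub_sub_cancel_right,
    hparts k' k'' hk' hk'' (by simpa using hp' 0), ← neg_add',
    ← intervalIntegral.integral_add (hinnerw hk'') (hinnerw (hAc.clm_apply hkc)), neg_eq_zero]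
  refine (intervalIntegral.integral_congr (g := fun _ => (0:ℝ)) fun t _ => ?_).trans
    intervalIntegral.integral_zero
  simp only
  rw [← inner_add_left, hJ, normalOp_symm hV,
    (mem_tangentSpaceAt_iff_normalOp hV hM hrep (hh.mem t) _).1 (hw.2 t), inner_zero_right]

end Curve

/-- Along a non-degenerate non-constant closed geodesic, the velocity spans the space of periodic
Jacobi fields. -/
theorem IsNondegenerateClosedGeodesic.exists_smul_deriv {V : Euc n → ℝ} {M : Set (Euc n)}
    {h : ℝ → Euc n} (hV : ContDiff ℝ ∞ V) (hM : IsNondegenerateCriticalHypersurface V M)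
    (hrep : IsRepulsive V M) (hh : IsNondegenerateClosedGeodesic M h) (hd : deriv h ≠ 0)
    {k k' k'' : ℝ → Euc n} (hp : Function.Periodic k 1)
    (hp' : Function.Periodic k' 1) (hk : ∀ t, HasDerivAt k (k' t) t)
    (hk' : ∀ t, HasDerivAt k' (k'' t) t) (hk'' : Continuous k'')
    (hT : ∀ t, normalOp V (h t) (k t) = 0)
    (hJ : ∀ t, k'' t + jacobiPotential V h t (k t)
      = normalOp V (h t) (k'' t + jacobiPotential V h t (k t))) :
    ∃ c : ℝ, k = c • deriv h := by
  obtain ⟨hg, k₀, -, -, huniq⟩ := hh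
  have hs := contDiff_deriv_infty hg.smooth
  have hs' := contDiff_deriv_infty hs
  obtain ⟨c₁, h₁⟩ := huniq k (mem_secondVariationKernel hV hM hrep hg hp hp' hk hk' hk''
    (fun t => (mem_tangentSpaceAt_iff_normalOp hV hM hrep (hg.mem t) _).2 (hT t)) hJ)
  -- The velocity lies in the kernel and is nonzero, so it may replace the given generator `k₀`.
  obtain ⟨c₂, h₂⟩ := huniq (deriv h) (mem_secondVariationKernel hV hM hrep hg
    (periodic_deriv hg.periodic) (periodic_deriv (periodic_deriv hg.periodic))
    (hasDerivAt_of_contDiff_infty hs) (hasDerivAt_of_contDiff_infty hs')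
    (contDiff_deriv_infty hs').continuous (deriv_mem_tangentSpaceAt hV hM hg)
    (jacobi_deriv hV hM hrep hg))
  have hc₂ : c₂ ≠ 0 := fun h0 => hd (by rw [h₂, h0, zero_smul])
  exact ⟨c₁ * c₂⁻¹, by rw [h₁, h₂, smul_smul, mul_assoc, inv_mul_cancel₀ hc₂, mul_one]⟩

/-! ### Lipschitz families uniform in the parameter, and contractions -/

section UniformlyLipschitz

/-- A family of maps that is bounded and Lipschitz on the closed unit ball, uniformly in the
parameter. -/
def UnifLip {ι X W : Type*} [NormedAddCommGroup X] [NormedAddCommGroup W] (Y : ι → X → W) : Prop :=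
  ∃ C : ℝ, ∀ i p q, ‖p‖ ≤ 1 → ‖q‖ ≤ 1 → ‖Y i p‖ ≤ C ∧ ‖Y i p - Y i q‖ ≤ C * ‖p - q‖

variable {ι X W W' W'' : Type*} [NormedAddCommGroup X] [NormedAddCommGroup W]
  [NormedAddCommGroup W'] [NormedAddCommGroup W'']

theorem UnifLip.const (w : W) : UnifLip fun (_ : ι) (_ : X) => w :=
  ⟨‖w‖, fun _ p q _ _ => ⟨le_rfl, by rw [sub_self, norm_zero]; positivity⟩⟩

theorem UnifLip.clm [NormedSpace ℝ X] [NormedSpace ℝ W] (L : ι → X →L[ℝ] W) (C : ℝ) (hL : ∀ i, ‖L i‖ ≤ C) :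
    UnifLip fun i p => L i p := by
  refine ⟨C, fun i p q hp hq => ⟨?_, ?_⟩⟩
  · exact ((L i).le_opNorm p).trans
      ((mul_le_of_le_one_right (norm_nonneg _) hp).trans (hL i))
  · rw [← map_sub]
    exact ((L i).le_opNorm _).trans (mul_le_mul_of_nonneg_right (hL i) (norm_nonneg _))

theorem UnifLip.add {Y Z : ι → X → W} (hY : UnifLip Y) (hZ : UnifLip Z) :
    UnifLip fun i p => Y i p + Z i p := by
  obtain ⟨C, hC⟩ := hY
  obtain ⟨D, hD⟩ := hZ
  refine ⟨C + D, fun i p q hp hq => ⟨?_, ?_⟩⟩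
  · exact (norm_add_le _ _).trans (add_le_add (hC i p q hp hq).1 (hD i p q hp hq).1)
  · rw [add_sub_add_comm, add_mul]
    exact (norm_add_le _ _).trans (add_le_add (hC i p q hp hq).2 (hD i p q hp hq).2)

theorem UnifLip.smul [NormedSpace ℝ W] {Y : ι → X → W} (hY : UnifLip Y) (a : ι → ℝ) (ha : ∀ i, |a i| ≤ 1) :
    UnifLip fun i p => a i • Y i p := by
  obtain ⟨C, hC⟩ := hY
  refine ⟨C, fun i p q hp hq => ⟨?_, ?_⟩⟩
  · rw [norm_smul]
    exact (mul_le_of_le_one_left (norm_nonneg _) (ha i)).trans (hC i p q hp hq).1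
  · rw [← smul_sub, norm_smul]
    exact (mul_le_of_le_one_left (norm_nonneg _) (ha i)).trans (hC i p q hp hq).2

theorem UnifLip.clm_comp [NormedSpace ℝ W] [NormedSpace ℝ W'] {Y : ι → X → W}
    (hY : UnifLip Y) (L : W →L[ℝ] W') :
    UnifLip fun i p => L (Y i p) := by
  obtain ⟨C, hC⟩ := hY
  refine ⟨‖L‖ * C, fun i p q hp hq => ⟨?_, ?_⟩⟩
  · exact (L.le_opNorm _).trans (mul_le_mul_of_nonneg_left (hC i p q hp hq).1 (norm_nonneg _))
  · rw [← map_sub, mul_assoc]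
    exact (L.le_opNorm _).trans (mul_le_mul_of_nonneg_left (hC i p q hp hq).2 (norm_nonneg _))

theorem UnifLip.bilin [NormedSpace ℝ W] [NormedSpace ℝ W'] [NormedSpace ℝ W'']
    {Y : ι → X → W} {Z : ι → X → W'} (hY : UnifLip Y) (hZ : UnifLip Z)
    (b : W →L[ℝ] W' →L[ℝ] W'') : UnifLip fun i p => b (Y i p) (Z i p) := by
  obtain ⟨C, hC⟩ := hY
  obtain ⟨D, hD⟩ := hZ
  refine ⟨2 * (‖b‖ * C * D), fun i p q hp hq => ?_⟩
  obtain ⟨h1, h2⟩ := hC i p q hp hq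
  obtain ⟨h3, h4⟩ := hD i p q hp hq
  have h5 := (hD i q p hq hp).1
  have hC0 : 0 ≤ C := (norm_nonneg _).trans h1
  have hD0 : 0 ≤ D := (norm_nonneg _).trans h3
  constructor
  · calc ‖b (Y i p) (Z i p)‖ ≤ ‖b‖ * ‖Y i p‖ * ‖Z i p‖ := b.le_opNorm₂ _ _
      _ ≤ ‖b‖ * C * D := by gcongr
      _ ≤ _ := by nlinarith [mul_nonneg (mul_nonneg (norm_nonneg b) hC0) hD0]
  · have e : b (Y i p) (Z i p) - b (Y i q) (Z i q)
        = b (Y i p) (Z i p - Z i q) + b (Y i p - Y i q) (Z i q) := by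
      simp only [map_sub, sub_apply]; abel
    calc _ ≤ ‖b‖ * ‖Y i p‖ * ‖Z i p - Z i q‖ + ‖b‖ * ‖Y i p - Y i q‖ * ‖Z i q‖ := by
          rw [e]
          exact (norm_add_le _ _).trans (add_le_add (b.le_opNorm₂ _ _) (b.le_opNorm₂ _ _))
      _ ≤ ‖b‖ * C * (D * ‖p - q‖) + ‖b‖ * (C * ‖p - q‖) * D := by gcongr
      _ = _ := by ring

end UniformlyLipschitz

/-- The contraction principle on the closed unit ball. -/
theorem exists_fixedPoint_of_contracting {X : Type*} [NormedAddCommGroup X] [CompleteSpace X]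
    (Ψ : X → X) {κ : ℝ} (hκ0 : 0 ≤ κ) (hκ : κ < 1) (hmaps : ∀ p, ‖p‖ ≤ 1 → ‖Ψ p‖ ≤ 1)
    (hlip : ∀ p q, ‖p‖ ≤ 1 → ‖q‖ ≤ 1 → ‖Ψ p - Ψ q‖ ≤ κ * ‖p - q‖) :
    ∃ p, ‖p‖ ≤ 1 ∧ Ψ p = p := by
  have hm : MapsTo Ψ (Metric.closedBall 0 1) (Metric.closedBall 0 1) := fun p hp => by
    rw [mem_closedBall_zero_iff] at hp ⊢
    exact hmaps p hp
  have hc : ContractingWith ⟨κ, hκ0⟩ (hm.restrict Ψ _ _) := by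
    refine ⟨by exact_mod_cast hκ, LipschitzWith.of_dist_le_mul fun p q => ?_⟩
    have := hlip p q (mem_closedBall_zero_iff.1 p.2) (mem_closedBall_zero_iff.1 q.2)
    rw [← dist_eq_norm, ← dist_eq_norm] at this
    exact this
  obtain ⟨p, hp, hfix, -⟩ := ContractingWith.exists_fixedPoint' Metric.isClosed_closedBall.isComplete
    hm hc (x := 0) (Metric.mem_closedBall_self zero_le_one) (edist_ne_top _ _)
  exact ⟨p, mem_closedBall_zero_iff.1 hp, hfix⟩

/-! ### Second order Taylor remainder -/

section Taylor

variable {F : Type*} [NormedAddCommGroup F] [NormedSpace ℝ F]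

/-- The remainder of the Taylor expansion of order two. -/
noncomputable def taylorRemainder (G : F → F) (p z : F) : F :=
  G (p + z) - G p - fderiv ℝ G p z - (2:ℝ)⁻¹ • fderiv ℝ (fderiv ℝ G) p z z

theorem taylorRemainder_zero (G : F → F) (p : F) : taylorRemainder G p 0 = 0 := by
  simp [taylorRemainder]

theorem continuous_taylorRemainder {G : F → F} (hG : ContDiff ℝ ∞ G) :
    Continuous fun q : F × F => taylorRemainder G q.1 q.2 := by
  have h1 : ContDiff ℝ ∞ (fderiv ℝ G) := hG.fderiv_right (by simp)
  have h2 : ContDiff ℝ ∞ (fderiv ℝ (fderiv ℝ G)) := h1.fderiv_right (by simp)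
  have c0 := hG.continuous
  have c1 := h1.continuous
  have c2 := h2.continuous
  unfold taylorRemainder
  fun_prop

/-- The second derivative of G is Lipschitz on the ball of radius R + ρ, so the second derivative of
the remainder in z is O(r), its first derivative is O(r²), and the mean value inequality concludes.
-/
theorem exists_taylorRemainder_lipschitz [ProperSpace F] {G : F → F} (hG : ContDiff ℝ ∞ G)
    (R ρ : ℝ) : ∃ C : ℝ, 0 ≤ C ∧ ∀ p, ‖p‖ ≤ R → ∀ r, r ≤ ρ → ∀ z w, ‖z‖ ≤ r → ‖w‖ ≤ r →
      ‖taylorRemainder G p z - taylorRemainder G p w‖ ≤ C * r ^ 2 * ‖z - w‖ := by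
  have h1 : ContDiff ℝ ∞ (fderiv ℝ G) := hG.fderiv_right (by simp)
  have h2 : ContDiff ℝ ∞ (fderiv ℝ (fderiv ℝ G)) := h1.fderiv_right (by simp)
  obtain ⟨L, hL⟩ := h2.contDiffOn.exists_lipschitzOnWith (by simp)
    (convex_closedBall (0:F) (R + ρ)) (isCompact_closedBall _ _)
  refine ⟨L, L.2, fun p hp r hr z w hz hw => ?_⟩
  have hr0 : 0 ≤ r := (norm_nonneg z).trans hz
  have hmem : ∀ v : F, ‖v‖ ≤ r → p + v ∈ Metric.closedBall (0:F) (R + ρ) := fun v hv => by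
    rw [mem_closedBall_zero_iff]
    exact (norm_add_le _ _).trans (add_le_add hp (hv.trans hr))
  have hshift : ∀ {W : Type _} [NormedAddCommGroup W] [NormedSpace ℝ W] {f : F → W}
      {f' : F →L[ℝ] W} {v : F}, HasFDerivAt f f' (p + v) →
        HasFDerivAt (fun v => f (p + v)) f' v := fun hf => by
    
    simpa using! hf.comp _ ((hasFDerivAt_id _).const_add p)
  have hD2 : ∀ v, ‖v‖ ≤ r →
      ‖fderiv ℝ (fderiv ℝ G) (p + v) - fderiv ℝ (fderiv ℝ G) p‖ ≤ L * r := by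
    intro v hv
    have := hL.dist_le_mul _ (hmem v hv) _ (by simpa using hmem 0 (by simpa using hr0))
    rw [dist_eq_norm, dist_eq_norm, add_sub_cancel_left] at this
    exact this.trans (mul_le_mul_of_nonneg_left hv L.2)
  have hconv := convex_closedBall (0:F) r
  have hD1 : ∀ v, ‖v‖ ≤ r →
      ‖fderiv ℝ G (p + v) - fderiv ℝ G p - fderiv ℝ (fderiv ℝ G) p v‖ ≤ L * r ^ 2 := by
    intro v hv
    have := hconv.norm_image_sub_le_of_norm_hasFDerivWithin_le (C := L * r)
      (f := fun v => fderiv ℝ G (p + v) - fderiv ℝ G p - fderiv ℝ (fderiv ℝ G) p v)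
      (f' := fun v => fderiv ℝ (fderiv ℝ G) (p + v) - fderiv ℝ (fderiv ℝ G) p)
      (fun v _ => (((hshift (h1.differentiable (by simp) (p + v)).hasFDerivAt).sub_const _).sub
        (fderiv ℝ (fderiv ℝ G) p).hasFDerivAt).hasFDerivWithinAt)
      (fun v hv => hD2 v (mem_closedBall_zero_iff.1 hv))
      (Metric.mem_closedBall_self hr0) (mem_closedBall_zero_iff.2 hv)
    simp only [add_zero, map_zero, sub_self, sub_zero] at this
    refine this.trans ?_
    rw [sq, ← mul_assoc]
    exact mul_le_mul_of_nonneg_left hv (mul_nonneg L.2 hr0)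
  have hsymm : ∀ u v, fderiv ℝ (fderiv ℝ G) p u v = fderiv ℝ (fderiv ℝ G) p v u :=
    hG.contDiffAt.isSymmSndFDerivAt two_le_smoothness
  refine hconv.norm_image_sub_le_of_norm_hasFDerivWithin_le
    (f' := fun v => fderiv ℝ G (p + v) - fderiv ℝ G p - fderiv ℝ (fderiv ℝ G) p v)
    (fun v _ => ?_) (fun v hv => hD1 v (mem_closedBall_zero_iff.1 hv))
    (mem_closedBall_zero_iff.2 hw) (mem_closedBall_zero_iff.2 hz)
  have hq : HasFDerivAt (fun v => (2:ℝ)⁻¹ • fderiv ℝ (fderiv ℝ G) p v v)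
      (fderiv ℝ (fderiv ℝ G) p v) v := by
    refine (((fderiv ℝ (fderiv ℝ G) p).hasFDerivAt.clm_apply (hasFDerivAt_id v)).const_smul
      (2:ℝ)⁻¹).congr_fderiv ?_
    ext u
    simp [hsymm u v]
    module
  exact ((((hshift (hG.differentiable (by simp) (p + v)).hasFDerivAt).sub_const _).sub
    (fderiv ℝ G p).hasFDerivAt).sub hq).hasFDerivWithinAt

end Taylor

/-! ### Nonlinear operators on loops and the rescaled Green operator -/

section LoopOperators

variable {F : Type*} [NormedAddCommGroup F]

/-- The action of a loop of bilinear maps on pairs of loops. -/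
noncomputable def Loop.act₂ [NormedSpace ℝ F] (B : Loop (F →L[ℝ] F →L[ℝ] F)) :
    Loop F →L[ℝ] Loop F →L[ℝ] Loop F :=
  LinearMap.mkContinuous₂
    (LinearMap.mk₂ ℝ (fun f g : Loop F => (⟨fun x => B x (f x) (g x),
        (B.continuous.clm_apply f.continuous).clm_apply g.continuous⟩ : Loop F))
      (fun f f' g => by ext x; simp) (fun a f g => by ext x; simp)
      (fun f g g' => by ext x; simp) (fun a f g => by ext x; simp)) (⨆ x, ‖B x‖) fun f g => by
    have hB : 0 ≤ ⨆ x, ‖B x‖ := Real.iSup_nonneg fun x => norm_nonneg (B x)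
    have hc : Continuous fun x => ‖B x‖ :=
      (continuous_norm (E := F →L[ℝ] F →L[ℝ] F)).comp B.continuous
    refine Loop.norm_le (by positivity) fun t => ((B t).le_opNorm₂ _ _).trans ?_
    gcongr
    · exact le_ciSup (isCompact_range hc).bddAbove _
    · exact f.norm_apply_le t
    · exact g.norm_apply_le t

@[simp] theorem Loop.act₂_apply [NormedSpace ℝ F] (B : Loop (F →L[ℝ] F →L[ℝ] F)) (f g : Loop F)
    (x : UnitAddCircle) : Loop.act₂ B f g x = B x (f x) (g x) := rfl

/-- The loop of Taylor remainders of `G` along a loop. -/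
noncomputable def Loop.remainder [NormedSpace ℝ F] {G : F → F} (hG : ContDiff ℝ ∞ G)
    (x₀ z : Loop F) : Loop F :=
  ⟨fun x => taylorRemainder G (x₀ x) (z x),
    (continuous_taylorRemainder hG).comp (x₀.continuous.prodMk z.continuous)⟩

/-- At radius of order δ⁵ the remainder has Lipschitz constant O(δ¹⁰), and its argument contributes
another δ⁵. Against the prefactor δ⁻¹² this leaves δ³ ≤ 1. -/
theorem UnifLip.remainder [NormedSpace ℝ F] [ProperSpace F] {G : F → F} (hG : ContDiff ℝ ∞ G)
    (x₀ : Loop F) {ι X : Type*} [NormedAddCommGroup X] [NormedSpace ℝ X] {Z : ι → X → Loop F}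
    (hZ : UnifLip Z) (δ : ι → ℝ) (hδ0 : ∀ i, 0 < δ i) (hδ1 : ∀ i, δ i ≤ 1) :
    UnifLip fun i p => (δ i ^ 12)⁻¹ • Loop.remainder hG x₀ (δ i ^ 5 • Z i p) := by
  obtain ⟨C, hC⟩ := hZ
  obtain ⟨D, hD0, hD⟩ := exists_taylorRemainder_lipschitz hG ‖x₀‖ C
  have key : ∀ i, ∀ u w : Loop F, ‖u‖ ≤ C → ‖w‖ ≤ C →
      ‖(δ i ^ 12)⁻¹ • Loop.remainder hG x₀ (δ i ^ 5 • u)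
        - (δ i ^ 12)⁻¹ • Loop.remainder hG x₀ (δ i ^ 5 • w)‖ ≤ D * C ^ 2 * ‖u - w‖ := by
    intro i u w hu hw
    have h0 := hδ0 i
    have hC0 : 0 ≤ C := (norm_nonneg u).trans hu
    have hsmall : ∀ v : Loop F, ‖v‖ ≤ C → ∀ t : ℝ,
        ‖(δ i ^ 5 • v) (t : UnitAddCircle)‖ ≤ δ i ^ 5 * C := fun v hv t => by
      rw [ContinuousMap.smul_apply, norm_smul, Real.norm_of_nonneg (by positivity)]
      gcongr
      exact (v.norm_apply_le t).trans hv
    refine Loop.norm_le (by positivity) fun t => ?_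
    rw [← smul_sub, ContinuousMap.smul_apply, norm_smul, norm_inv,
      Real.norm_of_nonneg (by positivity)]
    have h1 := hD (x₀ t) (x₀.norm_apply_le t) (δ i ^ 5 * C)
      (mul_le_of_le_one_left hC0 (pow_le_one₀ h0.le (hδ1 i))) _ _ (hsmall u hu t) (hsmall w hw t)
    have h2 : ‖(δ i ^ 5 • u) (t : UnitAddCircle) - (δ i ^ 5 • w) (t : UnitAddCircle)‖
        ≤ δ i ^ 5 * ‖u - w‖ := by
      rw [ContinuousMap.smul_apply, ContinuousMap.smul_apply, ← smul_sub, norm_smul,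
        Real.norm_of_nonneg (by positivity)]
      gcongr
      exact (u - w).norm_apply_le t
    calc (δ i ^ 12)⁻¹ * ‖taylorRemainder G (x₀ t) ((δ i ^ 5 • u) t)
          - taylorRemainder G (x₀ t) ((δ i ^ 5 • w) t)‖
        ≤ (δ i ^ 12)⁻¹ * (D * (δ i ^ 5 * C) ^ 2 * (δ i ^ 5 * ‖u - w‖)) := by
          gcongr
          exact h1.trans (by gcongr)
      _ = δ i ^ 3 * (D * C ^ 2 * ‖u - w‖) := by field_simp
      _ ≤ D * C ^ 2 * ‖u - w‖ :=
          mul_le_of_le_one_left (by positivity) (pow_le_one₀ h0.le (hδ1 i))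
  have hrem0 : Loop.remainder hG x₀ 0 = 0 := by
    ext1 x
    exact taylorRemainder_zero G _
  refine ⟨D * C ^ 2 * C, fun i p q hp hq => ⟨?_, ?_⟩⟩
  · have h1 := (hC i p q hp hq).1
    have hC0 : 0 ≤ C := (norm_nonneg _).trans h1
    have := key i (Z i p) 0 h1 (by simpa using hC0)
    rw [smul_zero, hrem0, smul_zero, sub_zero, sub_zero] at this
    exact this.trans (by gcongr)
  · have h1 := hC i p q hp hq
    have := key i (Z i p) (Z i q) h1.1 (hC i q p hq hp).1
    refine this.trans ?_
    rw [mul_assoc (D * C ^ 2)]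
    gcongr
    exact h1.2

/-- The periodic solution operator of `δ⁶ q'' - c q = g`, and its rescaled derivative. -/
theorem exists_scaled_green [NormedSpace ℝ F] [CompleteSpace F] {c δ : ℝ} (hc : 0 < c)
    (hδ : 0 < δ) :
    ∃ Q₀ Q₁ : Loop F →L[ℝ] Loop F,
      (∀ (g : Loop F) (t : ℝ), HasDerivAt (fun t : ℝ => Q₀ g (t : UnitAddCircle))
        ((δ ^ 3)⁻¹ • Q₁ g (t : UnitAddCircle)) t) ∧
      (∀ (g : Loop F) (t : ℝ), HasDerivAt (fun t : ℝ => Q₁ g (t : UnitAddCircle))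
        ((δ ^ 3)⁻¹ • (g (t : UnitAddCircle) + c • Q₀ g (t : UnitAddCircle))) t) ∧
      ‖Q₀‖ ≤ c⁻¹ ∧ ‖Q₁‖ ≤ (√c)⁻¹ := by
  have hsc : 0 < √c := Real.sqrt_pos.2 hc
  have hμ : 0 < √c * (δ ^ 3)⁻¹ := by positivity
  have hμ2 : (√c * (δ ^ 3)⁻¹) ^ 2 = c * (δ ^ 6)⁻¹ := by
    rw [mul_pow, Real.sq_sqrt hc.le]
    congr 1
    rw [inv_pow, ← pow_mul]
  obtain ⟨Q₀, Q₁, h₀, h₁, n₀, n₁⟩ := exists_green (F := F) hμ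
  -- Dividing the equation by δ⁶ gives μ² = c δ⁻⁶. Each derivative costs δ⁻³, and putting that
  -- factor aside keeps both operators bounded uniformly in δ.
  refine ⟨(δ ^ 6)⁻¹ • Q₀, (δ ^ 3)⁻¹ • Q₁, fun g t => ?_, fun g t => ?_, ?_, ?_⟩
  · refine ((h₀ g t).const_smul (δ ^ 6)⁻¹).congr_deriv ?_
    simp only [smul_apply, ContinuousMap.smul_apply, smul_smul]
    congr 1
    field_simp
  · refine ((h₁ g t).const_smul (δ ^ 3)⁻¹).congr_deriv ?_
    rw [hμ2]
    simp only [smul_apply, ContinuousMap.smul_apply, smul_smul]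
  · refine ContinuousLinearMap.opNorm_le_bound _ (by positivity) fun g => ?_
    rw [smul_apply, norm_smul, norm_inv, Real.norm_of_nonneg (by positivity)]
    calc (δ ^ 6)⁻¹ * ‖Q₀ g‖ ≤ (δ ^ 6)⁻¹ * (((√c * (δ ^ 3)⁻¹) ^ 2)⁻¹ * ‖g‖) := by
          gcongr; exact n₀ g
      _ = c⁻¹ * ‖g‖ := by rw [hμ2]; field_simp
  · refine ContinuousLinearMap.opNorm_le_bound _ (by positivity) fun g => ?_
    rw [smul_apply, norm_smul, norm_inv, Real.norm_of_nonneg (by positivity)]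
    calc (δ ^ 3)⁻¹ * ‖Q₁ g‖ ≤ (δ ^ 3)⁻¹ * ((√c * (δ ^ 3)⁻¹)⁻¹ * ‖g‖) := by
          gcongr; exact n₁ g
      _ = (√c)⁻¹ * ‖g‖ := by field_simp

end LoopOperators
-- The fixed point problem for the damped equation
theorem Loop.exists_pos_le (lam : Loop ℝ) (hlam : ∀ x, 0 < lam x) :
    ∃ m : ℝ, 0 < m ∧ ∀ x, m ≤ lam x := by
  obtain ⟨x, -, hx⟩ := isCompact_univ.exists_isMinOn (univ_nonempty (α := UnitAddCircle))
    lam.continuous.continuousOn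
  exact ⟨lam x, hlam x, fun y => hx (mem_univ y)⟩

/-- Periodic solutions of the damped equation `v'' + δ⁻⁶ G(v) = a x₀'` near a loop `x₀` of zeros
of `G`. -/
theorem exists_damped_solution {F : Type*} [NormedAddCommGroup F] [InnerProductSpace ℝ F]
    [FiniteDimensional ℝ F] {G : F → F} (hG : ContDiff ℝ ∞ G) (x₀ x₁ x₂ y y₁ y₂ : Loop F)
    (N N₁ N₂ A : Loop (F →L[ℝ] F)) (B : Loop (F →L[ℝ] F →L[ℝ] F)) (lam : Loop ℝ)
    (hx₁ : ∀ t : ℝ, HasDerivAt (fun t : ℝ => x₀ (t : UnitAddCircle)) (x₁ (t : UnitAddCircle)) t)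
    (hx₂ : ∀ t : ℝ, HasDerivAt (fun t : ℝ => x₁ (t : UnitAddCircle)) (x₂ (t : UnitAddCircle)) t)
    (hy₁ : ∀ t : ℝ, HasDerivAt (fun t : ℝ => y (t : UnitAddCircle)) (y₁ (t : UnitAddCircle)) t)
    (hy₂ : ∀ t : ℝ, HasDerivAt (fun t : ℝ => y₁ (t : UnitAddCircle)) (y₂ (t : UnitAddCircle)) t)
    (hN₁ : ∀ t : ℝ, HasDerivAt (fun t : ℝ => N (t : UnitAddCircle)) (N₁ (t : UnitAddCircle)) t)
    (hN₂ : ∀ t : ℝ, HasDerivAt (fun t : ℝ => N₁ (t : UnitAddCircle)) (N₂ (t : UnitAddCircle)) t)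
    (hlam : ∀ x, 0 < lam x) (hG0 : ∀ x, G (x₀ x) = 0)
    (hH : ∀ x v, fderiv ℝ G (x₀ x) v = -(lam x • N x v))
    (hB : ∀ x, fderiv ℝ (fderiv ℝ G) (x₀ x) = B x)
    (hA : ∀ x v, A x v = B x (y x) v) (hBs : ∀ x v w, B x v w = B x w v)
    (hx₂y : ∀ x, x₂ x = lam x • N x (y x))
    (hNN : ∀ x v, N x (N x v) = N x v)
    (hNB : ∀ x v w, N x v = 0 → N x w = 0 → N x (B x v w) = B x v w)
    (K₀ K₁ K₂ : Loop F →L[ℝ] Loop F) (α : Loop F →L[ℝ] ℝ)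
    (hK₁ : ∀ f, ∀ t : ℝ, HasDerivAt (fun t : ℝ => K₀ f (t : UnitAddCircle))
        (K₁ f (t : UnitAddCircle)) t)
    (hK₂ : ∀ f, ∀ t : ℝ, HasDerivAt (fun t : ℝ => K₁ f (t : UnitAddCircle))
        (K₂ f (t : UnitAddCircle)) t)
    (hNK : ∀ f x, N x (K₀ f x) = 0)
    (hK : ∀ f x, K₂ f x + A x (K₀ f x) - N x (K₂ f x + A x (K₀ f x)) - α f • x₁ x
        = f x - N x (f x)) :
    ∃ δ₀ : ℝ, 0 < δ₀ ∧ ∃ C : ℝ, ∀ δ, 0 < δ → δ ≤ δ₀ → ∃ (v v₁ v₂ : Loop F) (a : ℝ),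
      (∀ t : ℝ, HasDerivAt (fun t : ℝ => v (t : UnitAddCircle)) (v₁ (t : UnitAddCircle)) t) ∧
      (∀ t : ℝ, HasDerivAt (fun t : ℝ => v₁ (t : UnitAddCircle)) (v₂ (t : UnitAddCircle)) t) ∧
      (∀ x, v₂ x + (δ ^ 6)⁻¹ • G (v x) = a • x₁ x) ∧
      ‖v - x₀‖ ≤ C * δ ∧ ‖v₁ - x₁‖ ≤ C * δ := by
  have := FiniteDimensional.complete ℝ F
  have := FiniteDimensional.proper ℝ F
  obtain ⟨m, hm0, hm⟩ := lam.exists_pos_le hlam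
  -- The variable coefficient λ of the normal equation is frozen at its maximum; the error c - λ is
  -- then nonnegative and at most c - m.
  set c : ℝ := ‖lam‖ with hcdef
  have hlc : ∀ x, lam x ≤ c := fun x => (le_abs_self _).trans (lam.norm_coe_le_norm x)
  have hc : 0 < c := hm0.trans_le ((hm 0).trans (hlc 0))
  have hmc : m ≤ c := (hm 0).trans (hlc 0)
  let ι : Type := {δ : ℝ // 0 < δ ∧ δ ≤ 1}
  have hi0 : ∀ i : ι, 0 < i.1 := fun i => i.2.1
  have hi1 : ∀ (i : ι) (j : ℕ), |i.1 ^ j| ≤ 1 := fun i j => by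
    rw [abs_of_pos (pow_pos (hi0 i) j)]
    exact pow_le_one₀ (hi0 i).le i.2.2
  have hi1' : ∀ i : ι, |i.1| ≤ 1 := fun i => by simpa using hi1 i 1
  choose Q₀ Q₁ hQ₀ hQ₁ nQ₀ nQ₁ using fun i : ι => exists_scaled_green (F := F) hc (hi0 i)
  let X : Type _ := Loop F × Loop F
  let fstL : X →L[ℝ] Loop F := ContinuousLinearMap.fst ℝ (Loop F) (Loop F)
  let sndL : X →L[ℝ] Loop F := ContinuousLinearMap.snd ℝ (Loop F) (Loop F)
  let B₂ : Loop (F →L[ℝ] F →L[ℝ] F) := (2:ℝ)⁻¹ • B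
  let ρ : Loop F := y₂ + Loop.act₂ B₂ y y
  let cL : Loop ℝ := ContinuousMap.const _ c
  -- The unknown p = (f, g) consists of the right-hand sides. The displacement is v - x₀ = δ⁵ Z.
  let nq : ι → X → Loop F := fun i p => Loop.act N (Q₀ i p.2)
  let Z : ι → X → Loop F := fun i p => i.1 • y + (K₀ p.1 + i.1 ^ 4 • nq i p)
  -- All contributions to v'' + δ⁻⁶ G(v) of order δ⁶ and higher, divided by δ⁶.
  let Y : ι → X → Loop F := fun i p =>
    ρ + (Loop.act ((2:ℝ) • N₁) (Q₁ i p.2) + (i.1 ^ 3 • Loop.act (N₂ + A * N) (Q₀ i p.2)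
      + (i.1 ^ 2 • (Loop.act₂ B₂ (K₀ p.1) (nq i p) + (Loop.act₂ B₂ (nq i p) (K₀ p.1)
          + i.1 ^ 4 • Loop.act₂ B₂ (nq i p) (nq i p)))
        + (i.1 ^ 12)⁻¹ • Loop.remainder hG x₀ (i.1 ^ 5 • Z i p))))
  -- The source of the normal equation, which lives at order δ³. It carries one more factor δ in
  -- `Ψ`, so here the quadratic term of order δ⁴ has coefficient one.
  let W : ι → X → Loop F := fun i p =>
    i.1 • (K₂ p.1 + Loop.act A (K₀ p.1)) + (Loop.act₂ B₂ (K₀ p.1) (K₀ p.1) + i.1 ^ 2 • Y i p)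
  -- The first component is the tangential equation f = -δ P Y; the second moves the error of the
  -- frozen coefficient to the right-hand side.
  let Ψ : ι → X → X := fun i p =>
    (-(i.1 • Loop.act (1 - N) (Y i p)), -((cL - lam) • Q₀ i p.2 + i.1 • W i p))
  have lipK : ∀ L : Loop F →L[ℝ] Loop F, UnifLip fun (_ : ι) (p : X) => L p.1 := fun L =>
    UnifLip.clm (fun _ => L ∘L fstL) ‖L ∘L fstL‖ fun _ => le_rfl
  have lipS : ∀ (Q : ι → Loop F →L[ℝ] Loop F) (C : ℝ), (∀ i, ‖Q i‖ ≤ C) →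
      UnifLip fun (i : ι) (p : X) => Q i p.2 := fun Q C hQ => by
    refine UnifLip.clm (fun i => Q i ∘L sndL) C fun i => ?_
    refine (ContinuousLinearMap.opNorm_comp_le _ _).trans ?_
    exact (mul_le_of_le_one_right (norm_nonneg _)
      (ContinuousLinearMap.norm_snd_le ℝ (Loop F) (Loop F))).trans (hQ i)
  have lipq := lipS Q₀ _ nQ₀
  have lipq₁ := lipS Q₁ _ nQ₁
  have lipnq : UnifLip nq := lipq.clm_comp _
  have lipZ : UnifLip Z := ((UnifLip.const y).smul _ hi1').add
    ((lipK K₀).add (lipnq.smul _ fun i => hi1 i 4))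
  have lipY : UnifLip Y := (UnifLip.const ρ).add ((lipq₁.clm_comp _).add
    (((lipq.clm_comp _).smul _ fun i => hi1 i 3).add
      (((((lipK K₀).bilin lipnq _).add ((lipnq.bilin (lipK K₀) _).add
        ((lipnq.bilin lipnq _).smul _ fun i => hi1 i 4))).smul _ fun i => hi1 i 2).add
        (lipZ.remainder hG x₀ _ hi0 fun i => i.2.2))))
  have lipPY : UnifLip fun i p => Loop.act (1 - N) (Y i p) := lipY.clm_comp _
  have lipW : UnifLip W := (((lipK K₂).add ((lipK K₀).clm_comp (Loop.act A))).smul _ hi1').add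
    (((lipK K₀).bilin (lipK K₀) _).add (lipY.smul _ fun i => hi1 i 2))
  -- This family and the next are (v - x₀)/δ and (v' - x₀')/δ; only their boundedness is used.
  have lipD₀ : UnifLip fun (i : ι) (p : X) => i.1 ^ 5 • y + (i.1 ^ 4 • K₀ p.1
      + i.1 ^ 8 • nq i p) := ((UnifLip.const y).smul _ fun i => hi1 i 5).add
    (((lipK K₀).smul _ fun i => hi1 i 4).add (lipnq.smul _ fun i => hi1 i 8))
  have lipD₁ : UnifLip fun (i : ι) (p : X) => i.1 ^ 5 • y₁ + (i.1 ^ 4 • K₁ p.1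
      + (i.1 ^ 8 • Loop.act N₁ (Q₀ i p.2) + i.1 ^ 5 • Loop.act N (Q₁ i p.2))) :=
    ((UnifLip.const y₁).smul _ fun i => hi1 i 5).add (((lipK K₁).smul _ fun i => hi1 i 4).add
      (((lipq.clm_comp _).smul _ fun i => hi1 i 8).add
        ((lipq₁.clm_comp _).smul _ fun i => hi1 i 5)))
  obtain ⟨CY, hCY⟩ := lipPY
  obtain ⟨CW, hCW⟩ := lipW
  obtain ⟨C₀, hC₀⟩ := lipD₀
  obtain ⟨C₁, hC₁⟩ := lipD₁
  set Cm : ℝ := max 0 (max CY CW) with hCm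
  have hCm0 : 0 ≤ Cm := le_max_left _ _
  have hCYm : CY ≤ Cm := (le_max_left _ _).trans (le_max_right _ _)
  have hCWm : CW ≤ Cm := (le_max_right _ _).trans (le_max_right _ _)
  set θ : ℝ := (c - m) / c with hθ
  have hθ0 : 0 ≤ θ := div_nonneg (by linarith) hc.le
  have hθ1 : θ < 1 := by rw [hθ, div_lt_one hc]; linarith
  -- This choice gives δ `Cm` ≤ (1 - θ)/2, hence a contraction constant θ + δ `Cm` < 1; the added 1
  -- keeps the denominator positive.
  refine ⟨min 1 ((1 - θ) / (2 * (Cm + 1))), lt_min one_pos (div_pos (by linarith) (by linarith)),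
    max C₀ C₁, fun δ hδ0 hδ => ?_⟩
  let i : ι := ⟨δ, hδ0, hδ.trans (min_le_left _ _)⟩
  have hδC : δ * Cm ≤ (1 - θ) / 2 := by
    have h1 : δ ≤ (1 - θ) / (2 * (Cm + 1)) := hδ.trans (min_le_right _ _)
    rw [le_div_iff₀ (by linarith)] at h1
    nlinarith
  -- This is where the sharp bound 1/c of the Green operator is needed: (c - m)/c < 1 leaves no room
  -- for a larger constant.
  have hlin : ∀ q : Loop F, ‖(cL - lam) • Q₀ i q‖ ≤ θ * ‖q‖ := by
    intro q
    refine Loop.norm_le (by positivity) fun t => ?_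
    have e : ((cL - lam) • Q₀ i q) (t : UnitAddCircle)
        = (c - lam (t : UnitAddCircle)) • Q₀ i q (t : UnitAddCircle) := rfl
    rw [e, norm_smul, Real.norm_of_nonneg (sub_nonneg.2 (hlc _))]
    calc (c - lam (t : UnitAddCircle)) * ‖Q₀ i q (t : UnitAddCircle)‖
        ≤ (c - m) * (c⁻¹ * ‖q‖) := by
          refine mul_le_mul (by linarith [hm t]) ?_ (norm_nonneg _) (by linarith)
          exact ((Q₀ i q).norm_apply_le t).trans (((Q₀ i).le_opNorm q).trans
            (mul_le_mul_of_nonneg_right (nQ₀ i) (norm_nonneg _)))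
      _ = θ * ‖q‖ := by rw [hθ]; ring
  obtain ⟨p, hp1, hp⟩ := exists_fixedPoint_of_contracting (Ψ i) (κ := θ + δ * Cm) (by positivity)
    (by linarith) (fun p hp => by
      have h2 : ‖p.2‖ ≤ 1 := (norm_snd_le p).trans hp
      refine max_le ?_ ?_
      · simp only [Ψ]
        rw [norm_neg, norm_smul, Real.norm_of_nonneg hδ0.le]
        have := (hCY i p p hp hp).1
        calc δ * _ ≤ δ * Cm := by gcongr; exact this.trans hCYm
          _ ≤ 1 := by linarith
      · simp only [Ψ]
        rw [norm_neg]
        refine (norm_add_le _ _).trans ?_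
        rw [norm_smul i.1, Real.norm_of_nonneg hδ0.le]
        have h3 := (hCW i p p hp hp).1
        calc _ ≤ θ * 1 + δ * Cm := by
              gcongr
              · exact (hlin _).trans (by gcongr)
              · exact h3.trans hCWm
          _ ≤ 1 := by linarith)
    (fun p q hp hq => by
      have h2 : ‖p.2 - q.2‖ ≤ ‖p - q‖ := norm_snd_le (p - q)
      refine max_le ?_ ?_
      · change ‖-(i.1 • Loop.act (1 - N) (Y i p)) - -(i.1 • Loop.act (1 - N) (Y i q))‖ ≤ _
        rw [← neg_sub', norm_neg, ← smul_sub, norm_smul, Real.norm_of_nonneg hδ0.le]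
        have := (hCY i p q hp hq).2
        calc δ * _ ≤ δ * (Cm * ‖p - q‖) := by gcongr; exact this.trans (by gcongr)
          _ ≤ (θ + δ * Cm) * ‖p - q‖ := by
            rw [← mul_assoc]; gcongr; linarith
      · change ‖-((cL - lam) • Q₀ i p.2 + i.1 • W i p) - -((cL - lam) • Q₀ i q.2 + i.1 • W i q)‖ ≤ _
        rw [← neg_sub', norm_neg, add_sub_add_comm, ← smul_sub, ← smul_sub, ← map_sub]
        refine (norm_add_le _ _).trans ?_
        rw [norm_smul i.1, Real.norm_of_nonneg hδ0.le, add_mul, mul_assoc]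
        have h3 := (hCW i p q hp hq).2
        gcongr
        · exact (hlin _).trans (by gcongr)
        · exact h3.trans (by gcongr))
  set f : Loop F := p.1 with hfdef
  set g : Loop F := p.2 with hgdef
  set q : Loop F := Q₀ i g with hqdef
  set q₁ : Loop F := Q₁ i g with hq₁def
  let v : Loop F := x₀ + δ ^ 6 • y + δ ^ 5 • K₀ f + δ ^ 9 • Loop.act N q
  let v₁ : Loop F := x₁ + δ ^ 6 • y₁ + δ ^ 5 • K₁ f + (δ ^ 9 • Loop.act N₁ q
    + δ ^ 6 • Loop.act N q₁)
  let v₂ : Loop F := x₂ + δ ^ 6 • y₂ + δ ^ 5 • K₂ f + (δ ^ 9 • Loop.act N₂ q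
    + δ ^ 6 • Loop.act ((2:ℝ) • N₁) q₁ + δ ^ 3 • Loop.act N (g + c • q))
  refine ⟨v, v₁, v₂, δ ^ 5 * α f, fun t => ?_, fun t => ?_, fun x => ?_, ?_, ?_⟩
  · refine ((((hx₁ t).add ((hy₁ t).const_smul (δ ^ 6))).add ((hK₁ f t).const_smul (δ ^ 5))).add
      (((hN₁ t).clm_apply (hQ₀ i g t)).const_smul (δ ^ 9))).congr_deriv ?_
    simp only [v₁, ContinuousMap.add_apply, ContinuousMap.smul_apply, Loop.act_apply, map_smul,
      smul_add, smul_smul]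
    congr 3
    change δ ^ 9 * (δ ^ 3)⁻¹ = δ ^ 6
    field_simp
  · refine ((((hx₂ t).add ((hy₂ t).const_smul (δ ^ 6))).add ((hK₂ f t).const_smul (δ ^ 5))).add
      ((((hN₂ t).clm_apply (hQ₀ i g t)).const_smul (δ ^ 9)).add
        (((hN₁ t).clm_apply (hQ₁ i g t)).const_smul (δ ^ 6)))).congr_deriv ?_
    simp only [v₂, ContinuousMap.add_apply, ContinuousMap.smul_apply, Loop.act_apply, map_smul,
      map_add, smul_apply, i]
    match_scalars <;> field_simp <;> ring
  · have hf : f x = -(δ • (Y i p x - N x (Y i p x))) := by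
      have h1 : f = (Ψ i p).1 := by rw [hp]
      have h2 := congrArg (fun l : Loop F => l x) h1
      simpa [Ψ] using h2
    have hg : g x = -((c - lam x) • q x + δ • W i p x) := by
      have h1 : g = (Ψ i p).2 := by rw [hp]
      have h2 := congrArg (fun l : Loop F => l x) h1
      exact h2
    -- The fixed point equation makes `f` tangential, so the Jacobi equation holds with right-hand
    -- side exactly `f`.
    have hNf : N x (f x) = 0 := by
      rw [hf, map_neg, map_smul, map_sub, hNN, sub_self, smul_zero, neg_zero]
    have hsol := hK f x
    rw [hNf, sub_zero, map_add] at hsol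
    have hW : W i p x = δ • (K₂ f x + A x (K₀ f x)) + ((2:ℝ)⁻¹ • B x (K₀ f x) (K₀ f x)
        + δ ^ 2 • Y i p x) := by
      simp [W, B₂, i, f]
    have hNg : N x (g x) = -((c - lam x) • N x (q x) + δ • (δ • (N x (K₂ f x)
        + N x (A x (K₀ f x))) + ((2:ℝ)⁻¹ • B x (K₀ f x) (K₀ f x) + δ ^ 2 • N x (Y i p x)))) := by
      rw [hg, hW]
      simp only [map_neg, map_add, map_smul, hNB x _ _ (hNK f x) (hNK f x)]
    have hY : Y i p x = y₂ x + (2:ℝ)⁻¹ • B x (y x) (y x) + ((2:ℝ) • N₁ x (q₁ x)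
        + (δ ^ 3 • (N₂ x (q x) + A x (N x (q x))) + (δ ^ 2 • ((2:ℝ)⁻¹ • B x (K₀ f x) (N x (q x))
          + ((2:ℝ)⁻¹ • B x (N x (q x)) (K₀ f x)
            + δ ^ 4 • (2:ℝ)⁻¹ • B x (N x (q x)) (N x (q x))))
        + (δ ^ 12)⁻¹ • taylorRemainder G (x₀ x) (δ ^ 5 • Z i p x)))) := rfl
    have hZ : Z i p x = δ • y x + (K₀ f x + δ ^ 4 • N x (q x)) := rfl
    have hv : v x = x₀ x + δ ^ 5 • Z i p x := by
      rw [hZ]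
      simp only [v, ContinuousMap.add_apply, ContinuousMap.smul_apply, Loop.act_apply]
      module
    set r : F := (δ ^ 12)⁻¹ • taylorRemainder G (x₀ x) (δ ^ 5 • Z i p x) with hr
    have hδ12 : δ ^ 12 ≠ 0 := (pow_pos hδ0 12).ne'
    have hr' : taylorRemainder G (x₀ x) (δ ^ 5 • Z i p x) = δ ^ 12 • r := by
      rw [hr, smul_smul, mul_inv_cancel₀ hδ12, one_smul]
    have hGv : G (v x) = δ ^ 6 • (δ ^ 6 • r - lam x • N x (y x) - (δ ^ 3 * lam x) • N x (q x)
        + (δ ^ 4 * 2⁻¹) • B x (Z i p x) (Z i p x)) := by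
      have h1 : taylorRemainder G (x₀ x) (δ ^ 5 • Z i p x) = G (v x)
          + δ ^ 5 • lam x • N x (Z i p x)
          - (2:ℝ)⁻¹ • δ ^ 5 • δ ^ 5 • B x (Z i p x) (Z i p x) := by
        rw [taylorRemainder, hG0, hH, hB, ← hv]
        simp only [map_smul, smul_apply]
        module
      rw [hr'] at h1
      have h2 : N x (Z i p x) = δ • N x (y x) + δ ^ 4 • N x (q x) := by
        rw [hZ]
        simp only [map_add, map_smul, hNN, hNK, zero_add]
      rw [h2] at h1
      linear_combination (norm := module) -h1
    rw [hGv, inv_smul_smul₀ (pow_pos hδ0 6).ne']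
    have hBZ : B x (Z i p x) (Z i p x) = δ ^ 2 • B x (y x) (y x)
        + (2 * δ) • (A x (K₀ f x) + δ ^ 4 • A x (N x (q x))) + B x (K₀ f x) (K₀ f x)
        + δ ^ 4 • (B x (K₀ f x) (N x (q x)) + B x (N x (q x)) (K₀ f x))
        + δ ^ 8 • B x (N x (q x)) (N x (q x)) := by
      rw [hZ]
      simp only [map_add, map_smul, add_apply, smul_apply, hA, hBs x _ (y x)]
      module
    have hv₂ : v₂ x = x₂ x + δ ^ 6 • y₂ x + δ ^ 5 • K₂ f x + (δ ^ 9 • N₂ x (q x)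
        + δ ^ 6 • (2:ℝ) • N₁ x (q₁ x) + δ ^ 3 • (N x (g x) + c • N x (q x))) := by
      simp [v₂]
    rw [hv₂, hBZ, hNg]
    have hx := hx₂y x
    -- Order δ⁰ cancels by the choice of y and the normal part by the equation for `g`.
    -- Tangentially, δ⁵ (f + α(f) x₁) + δ⁶ P Y reduces to δ⁵ α(f) x₁.
    linear_combination (norm := module) hx + (δ ^ 5) • hsol + (δ ^ 5) • hf - (δ ^ 6) • hY
  · have h1 := (hC₀ i p p hp1 hp1).1
    have e : v - x₀ = δ • (δ ^ 5 • y + (δ ^ 4 • K₀ f + δ ^ 8 • nq i p)) := by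
      simp only [v, nq]
      module
    rw [e, norm_smul, Real.norm_of_nonneg hδ0.le, mul_comm]
    exact mul_le_mul_of_nonneg_right (h1.trans (le_max_left _ _)) hδ0.le
  · have h1 := (hC₁ i p p hp1 hp1).1
    have e : v₁ - x₁ = δ • (δ ^ 5 • y₁ + (δ ^ 4 • K₁ f + (δ ^ 8 • Loop.act N₁ q
        + δ ^ 5 • Loop.act N q₁))) := by
      simp only [v₁]
      module
    rw [e, norm_smul, Real.norm_of_nonneg hδ0.le, mul_comm]
    exact mul_le_mul_of_nonneg_right (h1.trans (le_max_right _ _)) hδ0.le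

/-! ### Removing the damping by conservation of energy -/

/-- Conservation of energy: a periodic solution of the damped equation whose damping term is not
orthogonal to its velocity is undamped. -/
theorem damping_eq_zero {V : Euc n → ℝ} (hV : Differentiable ℝ V) {v v₁ v₂ z : Loop (Euc n)}
    {a b : ℝ}
    (hv : ∀ t : ℝ, HasDerivAt (fun t : ℝ => v (t : UnitAddCircle)) (v₁ (t : UnitAddCircle)) t)
    (hv₁ : ∀ t : ℝ, HasDerivAt (fun t : ℝ => v₁ (t : UnitAddCircle)) (v₂ (t : UnitAddCircle)) t)
    (heq : ∀ x, v₂ x + b • gradient V (v x) = a • z x) (hz : z.pair v₁ ≠ 0) : a = 0 := by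
  -- Only the damping term does work, and the total work over a period is zero.
  have hE : ∀ t : ℝ, HasDerivAt (fun t : ℝ => 2⁻¹ * ⟪v₁ (t : UnitAddCircle), v₁ (t : UnitAddCircle)⟫
      + b * V (v (t : UnitAddCircle))) (a * ⟪z (t : UnitAddCircle), v₁ (t : UnitAddCircle)⟫) t := by
    intro t
    have h1 : HasDerivAt (fun t : ℝ => V (v (t : UnitAddCircle)))
        ⟪gradient V (v (t : UnitAddCircle)), v₁ (t : UnitAddCircle)⟫ t := by
      have h := (hV (v (t : UnitAddCircle))).hasGradientAt.hasFDerivAt.comp_hasDerivAt t (hv t)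
      rw [InnerProductSpace.toDual_apply_apply] at h
      exact h
    refine ((((hv₁ t).inner ℝ (hv₁ t)).const_mul 2⁻¹).add (h1.const_mul b)).congr_deriv ?_
    rw [← real_inner_smul_left (z (t : UnitAddCircle)), ← heq, inner_add_left,
      real_inner_smul_left, real_inner_comm (v₂ (t : UnitAddCircle))]
    ring
  have h := intervalIntegral.integral_eq_sub_of_hasDerivAt (a := (0:ℝ)) (b := 1)
    (fun t _ => hE t) (((z.continuous_inner v₁).const_mul a).intervalIntegrable _ _)
  have h1 : ((1:ℝ) : UnitAddCircle) = ((0:ℝ) : UnitAddCircle) := by simp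
  rw [h1, sub_self, intervalIntegral.integral_const_mul, ← Loop.pair_apply] at h
  exact (mul_eq_zero.1 h).resolve_right hz

/-- Near a non-degenerate non-constant closed geodesic, `v'' + δ⁻⁶ V'(v) = 0` has a `1`-periodic
solution for all small `δ`. -/
theorem exists_rescaled_solution {V : Euc n → ℝ} {M : Set (Euc n)} {h : ℝ → Euc n}
    (hV : ContDiff ℝ ∞ V) (hM : IsNondegenerateCriticalHypersurface V M)
    (hrep : IsRepulsive V M) (hh : IsNondegenerateClosedGeodesic M h) (hd : deriv h ≠ 0) :
    ∃ δ₀ : ℝ, 0 < δ₀ ∧ ∃ C : ℝ, ∀ δ, 0 < δ → δ ≤ δ₀ → ∃ v v₁ v₂ : Loop (Euc n),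
      (∀ t : ℝ, HasDerivAt (fun t : ℝ => v (t : UnitAddCircle)) (v₁ (t : UnitAddCircle)) t) ∧
      (∀ t : ℝ, HasDerivAt (fun t : ℝ => v₁ (t : UnitAddCircle)) (v₂ (t : UnitAddCircle)) t) ∧
      (∀ x, v₂ x + (δ ^ 6)⁻¹ • gradient V (v x) = 0) ∧
      (∀ t : ℝ, ‖v (t : UnitAddCircle) - h t‖ ≤ C * δ) ∧
      ∀ t : ℝ, ‖v₁ (t : UnitAddCircle) - deriv h t‖ ≤ C * δ := by
  have hg := hh.1
  have s₀ := hg.smooth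
  have s₁ := contDiff_deriv_infty s₀
  have s₂ := contDiff_deriv_infty s₁
  have s₃ := contDiff_deriv_infty s₂
  have sN := contDiff_normalOp_comp hV hM hrep hg
  have sN₁ := contDiff_deriv_infty sN
  have sy := contDiff_normalCorrection hV hM hrep hg
  have sy₁ := contDiff_deriv_infty sy
  have p₀ := hg.periodic
  have p₁ := periodic_deriv p₀
  have p₂ := periodic_deriv p₁
  have pN : Function.Periodic (fun t => normalOp V (h t)) 1 := fun t => by
    simp only [p₀ t]
  have pN₁ := periodic_deriv pN
  have py := periodic_normalCorrection (V := V) hg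
  have py₁ := periodic_deriv py
  let x₀ := loopOf h s₀.continuous p₀
  let x₁ := loopOf (deriv h) s₁.continuous p₁
  let x₂ := loopOf (deriv (deriv h)) s₂.continuous p₂
  let x₃ := loopOf (deriv (deriv (deriv h))) s₃.continuous (periodic_deriv p₂)
  let N := loopOf _ sN.continuous pN
  let N₁ := loopOf _ sN₁.continuous pN₁
  let N₂ := loopOf _ (contDiff_deriv_infty sN₁).continuous (periodic_deriv pN₁)
  let y := loopOf _ sy.continuous py
  let y₁ := loopOf _ sy₁.continuous py₁
  let y₂ := loopOf _ (contDiff_deriv_infty sy₁).continuous (periodic_deriv py₁)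
  let A := loopOf _ (contDiff_jacobiPotential hV hM hrep hg).continuous
    (periodic_jacobiPotential (V := V) hg)
  let B : Loop (Euc n →L[ℝ] Euc n →L[ℝ] Euc n) :=
    loopOf (fun t => thirdOp V (h t)) ((contDiff_thirdOp hV).continuous.comp s₀.continuous)
      fun t => by simp only [p₀ t]
  let lam : Loop ℝ := loopOf (fun t => -hessTrace V (h t))
    ((contDiff_hessTrace hV).continuous.comp s₀.continuous).neg fun t => by simp only [p₀ t]
  have circ : ∀ {P : UnitAddCircle → Prop}, (∀ t : ℝ, P (t : UnitAddCircle)) → ∀ x, P x :=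
    fun hP x => by
      obtain ⟨t, rfl⟩ := QuotientAddGroup.mk_surjective x
      exact hP t
  have hx₁0 : x₁ ≠ 0 := fun h0 => hd (funext fun t => congrArg (fun l : Loop (Euc n) => l t) h0)
  have hyp : ∀ x, x₂ x = lam x • N x (y x) := circ fun t => by
    have h1 := hessOp_normalCorrection hV hM hrep hg t
    rw [hessOp_eq hV hM hrep (hg.mem t), smul_apply] at h1
    change deriv (deriv h) t = -hessTrace V (h t) • normalOp V (h t) (normalCorrection V h t)
    rw [neg_smul, h1, neg_neg]
  have hNN : ∀ x v, N x (N x v) = N x v := circ fun t => normalOp_idem hV hM hrep (hg.mem t)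
  obtain ⟨K₀, K₁, K₂, α, hK₁, hK₂, hNK, hK⟩ := exists_tangential_solver N N₁ N₂ A x₁ x₂ x₃
    (hasDerivAt_of_contDiff_infty sN) (hasDerivAt_of_contDiff_infty sN₁) hNN
    (circ fun t => normalOp_symm hV (h t)) (circ fun t => thirdOp_symm hV (h t) _)
    (hasDerivAt_of_contDiff_infty s₁) (hasDerivAt_of_contDiff_infty s₂)
    (circ fun t => (mem_tangentSpaceAt_iff_normalOp hV hM hrep (hg.mem t) _).1
      (deriv_mem_tangentSpaceAt hV hM hg t))
    (circ fun t => jacobi_deriv hV hM hrep hg t) hx₁0 fun k k₁ k₂ hk₁ hk₂ hNk hJ => by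
      obtain ⟨c, hc⟩ := hh.exists_smul_deriv hV hM hrep hd k.periodic_lift k₁.periodic_lift hk₁ hk₂
        k₂.continuous_lift (fun t => hNk t) fun t => hJ t
      exact ⟨c, Loop.ext fun t => congrFun hc t⟩
  obtain ⟨δ₀, hδ₀, C, hC⟩ := exists_damped_solution (contDiff_gradient hV) x₀ x₁ x₂ y y₁ y₂
    N N₁ N₂ A B lam (hasDerivAt_of_contDiff_infty s₀) (hasDerivAt_of_contDiff_infty s₁)
    (hasDerivAt_of_contDiff_infty sy) (hasDerivAt_of_contDiff_infty sy₁)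
    (hasDerivAt_of_contDiff_infty sN) (hasDerivAt_of_contDiff_infty sN₁)
    (circ fun t => neg_pos.2 (hessTrace_neg hV hM hrep (hg.mem t)))
    (circ fun t => hM.critical _ (hg.mem t))
    (circ fun t v => by
      change hessOp V (h t) v = -(-hessTrace V (h t) • normalOp V (h t) v)
      rw [neg_smul, neg_neg, hessOp_eq hV hM hrep (hg.mem t), smul_apply])
    (circ fun t => rfl) (circ fun t v => rfl) (circ fun t => thirdOp_comm hV (h t)) hyp hNN
    (circ fun t v w hv hw => normalOp_thirdOp hV hM hrep (hg.mem t)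
      ((mem_tangentSpaceAt_iff_normalOp hV hM hrep (hg.mem t) _).2 hv)
      ((mem_tangentSpaceAt_iff_normalOp hV hM hrep (hg.mem t) _).2 hw))
    K₀ K₁ K₂ α hK₁ hK₂ hNK hK
  have hpos : 0 < x₁.pair x₁ := x₁.pair_self_nonneg.lt_of_ne' fun h0 =>
    hx₁0 (Loop.eq_zero_of_pair_self h0)
  -- The constants are chosen so that ⟨x₁, v₁⟩ differs from ⟨x₁, x₁⟩ by less than half of it, and so
  -- is nonzero.
  set D : ℝ := ‖x₁.pair‖ * |C| + 1 with hD
  have hD0 : 0 < D := by positivity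
  refine ⟨min δ₀ (x₁.pair x₁ / (2 * D)), lt_min hδ₀ (by positivity), C, fun δ hδ hδ' => ?_⟩
  obtain ⟨v, v₁, v₂, a, hv, hv₁, heq, hb, hb₁⟩ := hC δ hδ (hδ'.trans (min_le_left _ _))
  have hne : x₁.pair v₁ ≠ 0 := by
    have h1 : |x₁.pair (v₁ - x₁)| ≤ ‖x₁.pair‖ * (|C| * δ) :=
      (x₁.pair.le_opNorm _).trans (mul_le_mul_of_nonneg_left
        (hb₁.trans (mul_le_mul_of_nonneg_right (le_abs_self C) hδ.le)) (norm_nonneg _))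
    have h2 : δ * (2 * D) ≤ x₁.pair x₁ :=
      (le_div_iff₀ (by positivity)).1 (hδ'.trans (min_le_right _ _))
    rw [map_sub] at h1
    have h3 := (abs_le.1 h1).1
    have h4 : ‖x₁.pair‖ * (|C| * δ) = δ * D - δ := by rw [hD]; ring
    rw [h4] at h3
    nlinarith
  have ha := damping_eq_zero (hV.differentiable (by simp)) hv hv₁ heq hne
  refine ⟨v, v₁, v₂, hv, hv₁, fun x => by rw [heq, ha, zero_smul], fun t => ?_, fun t => ?_⟩
  · exact ((v - x₀).norm_apply_le t).trans hb
  · exact ((v₁ - x₁).norm_apply_le t).trans hb₁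

end SlowOrbits

/-! ### Return to period T -/

open SlowOrbits
theorem theorem1p1 (n : ℕ) (V : Euc n → ℝ) (hV : ContDiff ℝ ∞ V) (M : Set (Euc n))
    (hM : IsNondegenerateCriticalHypersurface V M) (hrep : IsRepulsive V M)
    (x₀ : ℝ → Euc n) (hx₀ : IsNondegenerateClosedGeodesic M x₀) :
    ∃ T₀ : ℝ, 0 < T₀ ∧ ∃ u : ℝ → ℝ → Euc n,
      (∀ T, T₀ ≤ T → IsPeriodicSolution V T (u T)) ∧
      TendstoC1 (fun T t => u T (T * t)) x₀ := by
  -- A constant geodesic is a critical point of V, and the constant function solves the equation for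
  -- every T.
  by_cases hd : deriv x₀ = 0
  · have hc : ∀ t, x₀ t = x₀ 0 := fun t =>
      is_const_of_deriv_eq_zero (hx₀.1.smooth.differentiable (by simp)) (congrFun hd) t 0
    refine ⟨1, one_pos, fun _ _ => x₀ 0, fun T _ => ⟨contDiff_const, fun _ => rfl, fun t => ?_⟩, ?_, ?_⟩
    · simp [hM.critical _ (hx₀.1.mem 0)]
    · rw [funext hc]
      exact (tendsto_const_nhds (x := x₀ 0)).tendstoUniformly_const
    · simp only [deriv_const', hd]
      exact (tendsto_const_nhds (x := (0 : Euc n))).tendstoUniformly_const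
  obtain ⟨δ₀, hδ₀, C, hC⟩ := exists_rescaled_solution hV hM hrep hx₀ hd
  -- With δ = T^(-1/3) the factor δ⁻⁶ is T², as rescaling time by T requires.
  have hδ : ∀ T : ℝ, (δ₀ ^ 3)⁻¹ ≤ T → 0 < T ^ (-(1/3) : ℝ) ∧ T ^ (-(1/3) : ℝ) ≤ δ₀ ∧
      ((T ^ (-(1/3) : ℝ)) ^ 6)⁻¹ = T ^ 2 := by
    intro T hT
    have hT0 : 0 < T := lt_of_lt_of_le (by positivity) hT
    have h3 : (T ^ (-(1/3) : ℝ)) ^ 3 = T⁻¹ := by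
      rw [← Real.rpow_natCast, ← Real.rpow_mul hT0.le]
      norm_num
      rw [Real.rpow_neg_one]
    refine ⟨by positivity, ?_, ?_⟩
    · refine le_of_pow_le_pow_left₀ (n := 3) (by norm_num) hδ₀.le ?_
      rw [h3]
      exact inv_le_of_inv_le₀ (by positivity) hT
    · rw [show (6:ℕ) = 3 * 2 by norm_num, pow_mul, h3, inv_pow, inv_inv]
  choose! v v₁ v₂ hv hv₁ heq hn hn₁ using fun T hT => hC _ (hδ T hT).1 (hδ T hT).2.1
  have hev : ∀ᶠ T : ℝ in atTop, (δ₀ ^ 3)⁻¹ ≤ T := eventually_ge_atTop _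
  have hlim : Tendsto (fun T : ℝ => C * T ^ (-(1/3) : ℝ)) atTop (𝓝 0) := by
    simpa using (tendsto_rpow_neg_atTop (y := 1/3) (by norm_num)).const_mul C
  have hscale : ∀ T : ℝ, (δ₀ ^ 3)⁻¹ ≤ T → T ≠ 0 := fun T hT =>
    (lt_of_lt_of_le (by positivity) hT).ne'
  have hres : ∀ T : ℝ, (δ₀ ^ 3)⁻¹ ≤ T →
      (fun t : ℝ => v T ((T * t / T : ℝ) : UnitAddCircle)) = fun t : ℝ => v T (t : UnitAddCircle) :=
    fun T hT => funext fun t => by rw [mul_div_cancel_left₀ _ (hscale T hT)]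
  refine ⟨(δ₀ ^ 3)⁻¹, by positivity, fun T t => v T ((t / T : ℝ) : UnitAddCircle), fun T hT => ?_,
    ?_, ?_⟩
  · have hT0 := hscale T hT
    have hs : ∀ t : ℝ, HasDerivAt (fun t : ℝ => t / T) T⁻¹ t := fun t => by
      simpa using (hasDerivAt_id t).div_const T
    have d1 : ∀ t : ℝ, HasDerivAt (fun t : ℝ => v T ((t / T : ℝ) : UnitAddCircle))
        (T⁻¹ • v₁ T ((t / T : ℝ) : UnitAddCircle)) t := fun t =>
      HasDerivAt.scomp (g₁ := fun s : ℝ => v T (s : UnitAddCircle)) t (hv T hT (t / T)) (hs t)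
    have d2 : ∀ t : ℝ, HasDerivAt (fun t : ℝ => T⁻¹ • v₁ T ((t / T : ℝ) : UnitAddCircle))
        (T⁻¹ • T⁻¹ • v₂ T ((t / T : ℝ) : UnitAddCircle)) t := fun t =>
      (HasDerivAt.scomp (g₁ := fun s : ℝ => v₁ T (s : UnitAddCircle)) t (hv₁ T hT (t / T))
        (hs t)).const_smul T⁻¹
    have e1 := deriv_eq d1
    have e2 := deriv_eq d2
    refine ⟨?_, fun t => ?_, fun t => ?_⟩
    · rw [show (2 : WithTop ℕ∞) = 1 + 1 by norm_num, contDiff_succ_iff_deriv]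
      refine ⟨fun t => (d1 t).differentiableAt, by simp, ?_⟩
      rw [e1, contDiff_one_iff_deriv]
      refine ⟨fun t => (d2 t).differentiableAt, ?_⟩
      rw [e2]
      exact (((v₂ T).continuous_lift.comp
        (by fun_prop : Continuous fun t : ℝ => t / T)).const_smul T⁻¹).const_smul T⁻¹
    · simp only [add_div, div_self hT0]
      exact (v T).periodic_lift _
    · rw [e1, e2]
      have h1 := heq T hT ((t / T : ℝ) : UnitAddCircle)
      rw [(hδ T hT).2.2] at h1
      have h2 := congrArg (fun w => (T ^ 2)⁻¹ • w) h1
      simp only [smul_add, smul_zero] at h2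
      rw [inv_smul_smul₀ (pow_ne_zero 2 hT0)] at h2
      simpa only [smul_smul, pow_two, mul_inv] using h2
  · rw [Metric.tendstoUniformly_iff]
    intro ε hε
    filter_upwards [hev, hlim.eventually (gt_mem_nhds hε)] with T hT hTε t
    rw [dist_comm, dist_eq_norm, congrFun (hres T hT) t]
    exact (hn T hT t).trans_lt hTε
  · rw [Metric.tendstoUniformly_iff]
    intro ε hε
    filter_upwards [hev, hlim.eventually (gt_mem_nhds hε)] with T hT hTε t
    rw [dist_comm, dist_eq_norm, hres T hT, (hv T hT t).deriv]
    exact (hn₁ T hT t).trans_lt hTε
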